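/- For $\alpha>0$ and $\beta\in\mathbb R$ let $T=T_{\alpha,\beta}:\mathbb R\to\mathbb R$ be given by $T(x)=\frac{\alpha}{2}\left(\frac{x+\beta}{\alpha}-\frac{\alpha}{x-\beta}\right)$ for $x\neq\beta$ and $T(\beta)=\beta$, and let $\mu_{\alpha,\beta}$ be the $T$-invariant probability measure $\mu_{\alpha,\beta}(A)=\frac{\alpha}{\pi}\int_A\frac{du}{\alpha^2+(u-\beta)^2}$ on $\mathbb R$. A sequence $\kappa=(k_n)_{n\ge 0}$ of natural numbers is called $L^p$-good universal if for every measure-preserving transformation $S$ of a probability space $(X,\mu)$ and every $g\in L^p(X,\mu)$ the limit $\lim_{N\to\infty}\frac1N\sum_{n=0}^{N-1}g(S^{k_n}x)$ exists for $\mu$-almost every $x$. **Theorem.** Let $\alpha>0$, $\beta,t\in\mathbb R$, and let $\kappa=(k_n)_{n\ge0}$ be $L^p$-good universal for some $p>2$. For $s=\sigma+it$ with $\frac12<\sigma<1$ put $$R_N(s,x,\kappa)=\frac1N\sum_{n=0}^{N-1}\zeta\left(s+iT^{k_n}x\right)\qquad(N=1,2,\dots).$$ (i) There is a constant $C>0$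 (depending on $\alpha,\beta,t,\kappa$ but not on $\sigma$) such that for all $\frac12<\sigma<1$ $$\sum_{N=1}^\infty\left\|R_{N+1}(s,\cdot,\kappa)-R_N(s,\cdot,\kappa)\right\|_2^2\le\frac{C}{\pi\sigma}\left|\frac{\zeta(2\sigma)}2+\frac{\zeta(2\sigma-1)}{2\sigma-1}\right|,$$ where $\|\cdot\|_2$ is the norm of $L^2(\mu_{\alpha,\beta})$. (ii) For every $\frac12<\sigma<1$ there is a constant $C>0$ (depending on $\alpha,\beta,s,\kappa$) such that for all $\lambda>0$ $$\mu_{\alpha,\beta}\left(\left\{x:\sum_{N=1}^\infty\left|R_{N+1}(s,x,\kappa)-R_N(s,x,\kappa)\right|^2\ge\lambda\right\}\right)\le\frac{C}{\lambda^2}\left|\frac{\zeta(2\sigma)}2+\frac{\zeta(2\sigma-1)}{2\sigma-1}\right|.$$ -/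

import Mathlib

open MeasureTheory ProbabilityTheory Filter Topology
open scoped ENNReal

/-- The sequence `k` of natural numbers is `L^p`-good universal: for every measure-preserving
system `(X, μ, T)` on a probability space and every `g ∈ L^p(μ)`, the averages
`(1/N) ∑_{n<N} g (T^{k n} x)` converge to a finite limit for `μ`-almost every `x`. -/
def IsGoodUniversal (p : ℝ≥0∞) (k : ℕ → ℕ) : Prop :=
  ∀ (X : Type) [MeasurableSpace X] (μ : Measure X) [IsProbabilityMeasure μ] (T : X → X),
    MeasurePreserving T μ μ → ∀ g : X → ℂ, MemLp g p μ →
      ∀ᵐ x ∂μ, ∃ l : ℂ,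
        Tendsto (fun N : ℕ => (1 / (N : ℂ)) * ∑ n ∈ Finset.range N, g (T^[k n] x)) atTop (𝓝 l)

/-- The Boolean-type map `T_{α,β}` of the real line. -/
noncomputable def boolMap (α β : ℝ) (x : ℝ) : ℝ :=
  if x = β then β else α / 2 * ((x + β) / α - α / (x - β))

/-- The probability measure `μ_{α,β}`, with density `(α / π) / (α ^ 2 + (t - β) ^ 2)` (`α > 0`). -/
noncomputable def muAB (α β : ℝ) : Measure ℝ :=
  cauchyMeasure β α.toNNReal

/-- The averages `R_N(s, x, k) = (1/N) ∑_{n=0}^{N-1} ζ(s + i T_{α,β}^{k n} x)`. -/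
noncomputable def zetaAvg (α β : ℝ) (s : ℂ) (k : ℕ → ℕ) (N : ℕ) (x : ℝ) : ℂ :=
  (1 / (N : ℂ)) * ∑ n ∈ Finset.range N,
    riemannZeta (s + Complex.I * (((boolMap α β)^[k n] x : ℝ) : ℂ))

/-- `∑_{N ≥ 1} |R_{N+1}(s, x, k) - R_N(s, x, k)| ^ 2`, as an element of `[0, ∞]`. -/
noncomputable def squareVar (α β : ℝ) (s : ℂ) (k : ℕ → ℕ) (x : ℝ) : ℝ≥0∞ :=
  ∑' N : ℕ, ‖zetaAvg α β s k (N + 2) x - zetaAvg α β s k (N + 1) x‖ₑ ^ 2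

/-- `|ζ(2σ) / 2 + ζ(2σ - 1) / (2σ - 1)|`. -/
noncomputable def zetaBound (σ : ℝ) : ℝ :=
  ‖riemannZeta (2 * (σ : ℂ)) / 2 + riemannZeta (2 * (σ : ℂ) - 1) / (2 * (σ : ℂ) - 1)‖

/-! With f(x) = ζ(s + ix), the increment R_{N+1} - R_N equals (f∘T^{k_N} - R_N)/(N+1). Since T
preserves μ, its L^p norm is at most 2‖f‖_p/(N+1), whatever the sequence k. The squares of these
weights are summable, so the sum in (i) is at most a constant times ‖f‖₂². A weighted Cauchy-Schwarz
inequality bounds the second moment of the square variation by a constant times ∫|f|⁴, and Markov's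
inequality then gives the λ⁻² decay in (ii).

It remains to compare moments of ζ with the zeta expression on the right. The pole at 1 makes ‖f‖₂²
of size at most C/(1 - σ), uniformly in σ (`exists_lintegral_riemannZeta_sq_le`), while the right
side is at least 1/(4(1 - σ)) (`inv_le_zetaBound`). In (ii) the constant may depend on σ, so a
finite fourth moment and a positive right side suffice.

Both moments are integrals against a weight of order (1 + y²)⁻¹, and both follow from the convexity
bound `exists_norm_riemannZeta₁_le_convexity`: estimates on Re s = 1 (series) and Re s = 0
(functional equation) are interpolated by the three lines theorem. The entire function
`riemannZeta₁`, i.e. (s - 1)ζ(s), is used throughout to avoid the pole. -/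

/-! ### Series for (s - 1)ζ(s) in the half-plane Re s > 0 -/

/-- The `n`-th term of the expansion `(s - 1) ζ(s) = 1 + ∑ n, zetaTerm s n`, valid for `0 < Re s`. -/
noncomputable def zetaTerm (s : ℂ) (n : ℕ) : ℂ :=
  (s - 1) * ((n + 1 : ℝ) : ℂ) ^ (-s) + ((n + 2 : ℝ) : ℂ) ^ (1 - s) - ((n + 1 : ℝ) : ℂ) ^ (1 - s)

lemma hasDerivAt_ofReal_cpow_of_pos (z : ℂ) {x : ℝ} (hx : 0 < x) :
    HasDerivAt (fun y : ℝ => (y : ℂ) ^ z) (z * (x : ℂ) ^ (z - 1)) x := by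
  have h := (hasDerivAt_id (x : ℂ)).cpow_const (c := z) (Or.inl (by simpa using hx))
  simpa using h.comp_ofReal

lemma norm_cpow_neg_sub_le {s : ℂ} (hs : 0 < s.re) {m x : ℝ} (hm : 0 < m)
    (hx : x ∈ Set.Icc m (m + 1)) :
    ‖(m : ℂ) ^ (-s) - (x : ℂ) ^ (-s)‖ ≤ ‖s‖ * m ^ (-s.re - 1) := by
  have key := norm_image_sub_le_of_norm_deriv_le_segment' (f := fun y : ℝ => (y : ℂ) ^ (-s))
    (f' := fun y : ℝ => -s * (y : ℂ) ^ (-s - 1)) (a := m) (b := m + 1)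
    (C := ‖s‖ * m ^ (-s.re - 1))
    (fun y hy => (hasDerivAt_ofReal_cpow_of_pos (-s) (hm.trans_le hy.1)).hasDerivWithinAt)
    (fun y hy => by
      rw [norm_mul, norm_neg, Complex.norm_cpow_eq_rpow_re_of_pos (hm.trans_le hy.1)]
      gcongr ?_ * ?_
      simpa using Real.rpow_le_rpow_of_nonpos hm hy.1 (by linarith : -s.re - 1 ≤ 0)) x hx
  rw [norm_sub_rev]
  refine key.trans ?_
  have : x - m ≤ 1 := by linarith [hx.2]
  have : 0 ≤ ‖s‖ * m ^ (-s.re - 1) := by positivity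
  nlinarith

lemma norm_cpow_neg_sub_le_two {s : ℂ} (hs : 0 < s.re) {m x : ℝ} (hm : 0 < m)
    (hx : x ∈ Set.Icc m (m + 1)) :
    ‖(m : ℂ) ^ (-s) - (x : ℂ) ^ (-s)‖ ≤ 2 * m ^ (-s.re) := by
  refine (norm_sub_le _ _).trans ?_
  rw [Complex.norm_cpow_eq_rpow_re_of_pos hm, Complex.norm_cpow_eq_rpow_re_of_pos (hm.trans_le hx.1)]
  have := Real.rpow_le_rpow_of_nonpos hm hx.1 (by linarith : -s.re ≤ 0)
  simp only [Complex.neg_re]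
  linarith

/-- With m = n + 1, the term is the integral of (s - 1)(m^(-s) - x^(-s)) over [m, m + 1]. The
difference has a mean value bound and a trivial bound; their geometric mean with weights θ and 1 - θ
trades decay in n against growth in |s|. Small θ is what later gives a good exponent on Re s = 1. -/
lemma norm_zetaTerm_le {s : ℂ} (hs : 0 < s.re) {θ : ℝ} (h0 : 0 ≤ θ) (h1 : θ ≤ 1) (n : ℕ) :
    ‖zetaTerm s n‖ ≤ ‖s - 1‖ * (2 * ‖s‖ ^ θ) * (n + 1 : ℝ) ^ (-(s.re + θ)) := by
  have hm : (0 : ℝ) < n + 1 := by positivity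
  set m : ℝ := n + 1 with hmdef
  have hdiff : ∀ x ∈ Set.Icc m (m + 1),
      ‖(m : ℂ) ^ (-s) - (x : ℂ) ^ (-s)‖ ≤ 2 * ‖s‖ ^ θ * m ^ (-(s.re + θ)) := by
    intro x hx
    set N := ‖(m : ℂ) ^ (-s) - (x : ℂ) ^ (-s)‖
    have hN : 0 ≤ N := norm_nonneg _
    calc N = N ^ θ * N ^ (1 - θ) := by
          rw [← Real.rpow_add_of_nonneg hN h0 (by linarith)]; simp
      _ ≤ (‖s‖ * m ^ (-s.re - 1)) ^ θ * (2 * m ^ (-s.re)) ^ (1 - θ) := by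
          gcongr
          · exact norm_cpow_neg_sub_le hs hm hx
          · exact norm_cpow_neg_sub_le_two hs hm hx
      _ = (2 : ℝ) ^ (1 - θ) * ‖s‖ ^ θ * m ^ (-(s.re + θ)) := by
          rw [Real.mul_rpow (by positivity) (by positivity),
            Real.mul_rpow (by positivity) (by positivity), ← Real.rpow_mul hm.le,
            ← Real.rpow_mul hm.le,
            show -(s.re + θ) = (-s.re - 1) * θ + (-s.re) * (1 - θ) by ring, Real.rpow_add hm]
          ring
      _ ≤ _ := by
          gcongr
          calc (2 : ℝ) ^ (1 - θ) ≤ 2 ^ (1 : ℝ) := by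
                apply Real.rpow_le_rpow_of_exponent_le <;> linarith
            _ = 2 := by simp
  have key := norm_image_sub_le_of_norm_deriv_le_segment'
    (f := fun y : ℝ => (s - 1) * (m : ℂ) ^ (-s) * (y : ℂ) + (y : ℂ) ^ (1 - s))
    (f' := fun y : ℝ => (s - 1) * (m : ℂ) ^ (-s) + (1 - s) * (y : ℂ) ^ (1 - s - 1))
    (a := m) (b := m + 1) (C := ‖s - 1‖ * (2 * ‖s‖ ^ θ) * m ^ (-(s.re + θ)))
    (fun y hy => by
      have h1 : HasDerivAt (fun y : ℝ => (s - 1) * (m : ℂ) ^ (-s) * (y : ℂ))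
          ((s - 1) * (m : ℂ) ^ (-s)) y := by
        simpa using (Complex.ofRealCLM.hasDerivAt (x := y)).const_mul ((s - 1) * (m : ℂ) ^ (-s))
      exact (h1.add (hasDerivAt_ofReal_cpow_of_pos (1 - s)
        (hm.trans_le hy.1))).hasDerivWithinAt)
    (fun y hy => by
      rw [show (s - 1) * (m : ℂ) ^ (-s) + (1 - s) * (y : ℂ) ^ (1 - s - 1)
        = (s - 1) * ((m : ℂ) ^ (-s) - (y : ℂ) ^ (-s)) by
          rw [show 1 - s - 1 = -s by ring]; ring, norm_mul, mul_assoc]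
      gcongr
      exact hdiff y ⟨hy.1, hy.2.le⟩) (m + 1) (by simp)
  calc ‖zetaTerm s n‖ = _ := by
        congr 1
        rw [zetaTerm, show (n + 2 : ℝ) = m + 1 by rw [hmdef]; ring]
        simp only [hmdef]
        push_cast
        ring
    _ ≤ _ := key
    _ = _ := by ring

lemma summable_nat_add_one_rpow_neg {a : ℝ} (ha : 1 < a) :
    Summable fun n : ℕ => (n + 1 : ℝ) ^ (-a) := by
  have := (summable_nat_add_iff 1).2 (Real.summable_nat_rpow.2 (by linarith : -a < -1))
  simpa using this

lemma summable_zetaTerm {s : ℂ} (hs : 0 < s.re) : Summable (zetaTerm s) :=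
  Summable.of_norm_bounded ((summable_nat_add_one_rpow_neg (by linarith : 1 < s.re + 1)).mul_left
    (‖s - 1‖ * (2 * ‖s‖ ^ (1 : ℝ)))) fun n => norm_zetaTerm_le hs zero_le_one le_rfl n

lemma differentiable_zetaTerm (n : ℕ) : Differentiable ℂ fun s => zetaTerm s n := by
  unfold zetaTerm
  have h1 : ((n + 1 : ℝ) : ℂ) ≠ 0 := by exact_mod_cast (by positivity : (n + 1 : ℝ) ≠ 0)
  have h2 : ((n + 2 : ℝ) : ℂ) ≠ 0 := by exact_mod_cast (by positivity : (n + 2 : ℝ) ≠ 0)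
  intro s
  refine DifferentiableAt.sub (DifferentiableAt.add (DifferentiableAt.mul (by fun_prop) ?_) ?_) ?_
  · exact DifferentiableAt.const_cpow (by fun_prop) (Or.inl h1)
  · exact DifferentiableAt.const_cpow (by fun_prop) (Or.inl h2)
  · exact DifferentiableAt.const_cpow (by fun_prop) (Or.inl h1)

lemma differentiableOn_tsum_zetaTerm :
    DifferentiableOn ℂ (fun s => 1 + ∑' n, zetaTerm s n) {s | 0 < s.re} := by
  intro s hs
  simp only [Set.mem_ofPred_eq] at hs
  -- A neighbourhood with Re bounded below and the norm bounded above, so that one summable majorant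
  -- serves all its points.
  set U : Set ℂ := {z | s.re / 2 < z.re} ∩ Metric.ball 0 (‖s‖ + 1)
  have hU : IsOpen U := (isOpen_lt continuous_const Complex.continuous_re).inter Metric.isOpen_ball
  have hsU : s ∈ U := ⟨by simp only [Set.mem_ofPred_eq]; linarith, by simp⟩
  refine (DifferentiableOn.differentiableAt (s := U) ?_
    (hU.mem_nhds hsU)).differentiableWithinAt
  refine DifferentiableOn.const_add _ (Complex.differentiableOn_tsum_of_summable_norm
    (u := fun n : ℕ => ((‖s‖ + 2) * (2 * (‖s‖ + 1))) * (n + 1 : ℝ) ^ (-(s.re / 2 + 1)))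
    ((summable_nat_add_one_rpow_neg (by linarith)).mul_left _)
    (fun n => (differentiable_zetaTerm n).differentiableOn) hU fun n w hw => ?_)
  have hw1 : s.re / 2 < w.re := hw.1
  have hw2 : ‖w‖ < ‖s‖ + 1 := by simpa using hw.2
  refine (norm_zetaTerm_le (by linarith) zero_le_one le_rfl n).trans ?_
  rw [Real.rpow_one]
  gcongr
  · refine (norm_sub_le _ _).trans ?_
    simp only [norm_one]; linarith
  · simp

lemma sum_zetaTerm (s : ℂ) (N : ℕ) :
    ∑ n ∈ Finset.range N, zetaTerm s n =
      (s - 1) * (∑ n ∈ Finset.range N, ((n + 1 : ℝ) : ℂ) ^ (-s)) +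
        ((N + 1 : ℝ) : ℂ) ^ (1 - s) - 1 := by
  induction N with
  | zero => simp
  | succ N ih =>
    rw [Finset.sum_range_succ, Finset.sum_range_succ, ih, zetaTerm]
    push_cast
    rw [show (N : ℂ) + 1 + 1 = N + 2 by ring]
    ring

/-- The partial sums telescope to a Dirichlet partial sum plus the boundary term (N + 1)^(1 - s),
which vanishes in the limit when Re s > 1. -/
lemma tsum_zetaTerm_of_one_lt_re {s : ℂ} (hs : 1 < s.re) :
    1 + ∑' n, zetaTerm s n = riemannZeta₁ s := by
  have hs1 : s ≠ 1 := by rintro rfl; simp at hs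
  have hlim : Tendsto (fun N : ℕ => ((N + 1 : ℝ) : ℂ) ^ (1 - s)) atTop (𝓝 0) := by
    rw [tendsto_zero_iff_norm_tendsto_zero]
    have h := (tendsto_rpow_neg_atTop (by linarith : 0 < s.re - 1)).comp
      (tendsto_natCast_atTop_atTop.comp (tendsto_add_atTop_nat 1) : Tendsto
        (fun N : ℕ => ((N + 1 : ℕ) : ℝ)) atTop atTop)
    refine h.congr fun N => ?_
    rw [Complex.norm_cpow_eq_rpow_re_of_pos (by positivity)]
    simp
  have hsum : HasSum (fun n : ℕ => ((n + 1 : ℝ) : ℂ) ^ (-s)) (riemannZeta s) := by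
    have hz := zeta_eq_tsum_one_div_nat_add_one_cpow hs
    have hsm : Summable (fun n : ℕ => 1 / ((n : ℂ) + 1) ^ s) := by
      have := (summable_nat_add_iff 1).2 (Complex.summable_one_div_nat_cpow.2 hs)
      simpa using this
    have := hsm.hasSum
    rw [← hz] at this
    convert! this using 2 with n
    rw [Complex.cpow_neg, one_div]
    push_cast
    rfl
  have h1 := (summable_zetaTerm (by linarith : 0 < s.re)).hasSum.tendsto_sum_nat
  have h2 := (((hsum.tendsto_sum_nat.const_mul (s - 1)).add hlim).sub_const 1)
  simp_rw [← sum_zetaTerm] at h2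
  rw [tendsto_nhds_unique h1 h2, riemannZeta_eq_inv_sub_mul hs1]
  have := sub_ne_zero.2 hs1
  field_simp
  ring

/-- Analytic continuation of `(s - 1) ζ(s)` to the half-plane `0 < Re s`. -/
lemma riemannZeta₁_eq_tsum {s : ℂ} (hs : 0 < s.re) :
    riemannZeta₁ s = 1 + ∑' n, zetaTerm s n := by
  have hopen : IsOpen {s : ℂ | 0 < s.re} := isOpen_lt continuous_const Complex.continuous_re
  refine ((differentiable_riemannZeta₁.differentiableOn.analyticOnNhd
    hopen).eqOn_of_preconnected_of_eventuallyEq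
    (differentiableOn_tsum_zetaTerm.analyticOnNhd hopen)
    (convex_halfSpace_re_gt 0).isPreconnected (z₀ := 2) (by simp) ?_) hs
  filter_upwards [(isOpen_lt continuous_const Complex.continuous_re).mem_nhds
    (by simp : (2 : ℂ) ∈ {z : ℂ | (1 : ℝ) < z.re})] with z hz
  exact (tsum_zetaTerm_of_one_lt_re hz).symm

/-- `|(s - 1) ζ(s)| ≤ 1 + K |s - 1| |s| ^ θ` uniformly on `1 < a ≤ Re s + θ`. -/
lemma exists_norm_riemannZeta₁_le {θ a : ℝ} (h0 : 0 ≤ θ) (h1 : θ ≤ 1) (ha : 1 < a) :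
    ∃ K : ℝ, 0 < K ∧ ∀ s : ℂ, 0 < s.re → a ≤ s.re + θ →
      ‖riemannZeta₁ s‖ ≤ 1 + K * ‖s - 1‖ * ‖s‖ ^ θ := by
  have hsum := summable_nat_add_one_rpow_neg ha
  refine ⟨2 * ∑' n : ℕ, (n + 1 : ℝ) ^ (-a), ?_, fun s hs hsa => ?_⟩
  · have := hsum.tsum_pos (fun n => by positivity) 0 (by simp)
    linarith
  · rw [riemannZeta₁_eq_tsum hs]
    refine (norm_add_le _ _).trans ?_
    rw [norm_one]
    gcongr
    have := tsum_of_norm_bounded (hsum.hasSum.mul_left (‖s - 1‖ * (2 * ‖s‖ ^ θ)))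
      (f := zetaTerm s) (fun n => (norm_zetaTerm_le hs h0 h1 n).trans (by
        gcongr
        simp))
    refine this.trans (le_of_eq (by ring))

/-! ### Lower bound for the zeta expression on the right-hand side -/

/-- Integral comparison behind the upper bound for `ζ (v + 1) / 2 + ζ v / v`. -/
lemma rpow_integral_comparison {v m : ℝ} (hv0 : 0 < v) (hv1 : v < 1) (hm : 0 < m) :
    m ^ (-v) / v - ((m + 1) ^ (1 - v) - m ^ (1 - v)) / (v * (1 - v)) ≤
      (m ^ (-v) - (m + 1) ^ (-v)) / v - (m + 1) ^ (-(v + 1)) / 2 := by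
  -- P is an antiderivative of (t - m)(t^(-(v+1)) - (m+1)^(-(v+1))), which is nonnegative on [m, m +
  -- 1]; P(m) ≤ P(m + 1) rearranges to the claim.
  set P : ℝ → ℝ := fun t => t ^ (1 - v) / (1 - v) + m * t ^ (-v) / v -
    (m + 1) ^ (-(v + 1)) * (t - m) ^ 2 / 2 with hP
  have hd : ∀ t, 0 < t → HasDerivAt P ((t - m) * (t ^ (-(v + 1)) - (m + 1) ^ (-(v + 1)))) t := by
    intro t ht
    have h1 := (Real.hasDerivAt_rpow_const (x := t) (p := 1 - v) (Or.inl ht.ne')).div_const (1 - v)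
    have h2 := ((Real.hasDerivAt_rpow_const (x := t) (p := -v) (Or.inl ht.ne')).const_mul m).div_const v
    have h3 := ((((hasDerivAt_id t).sub_const m).pow 2).const_mul ((m + 1) ^ (-(v + 1)))).div_const 2
    convert! (h1.add h2).sub h3 using 1
    have e : t ^ (-v) = t * t ^ (-(v + 1)) := by
      rw [show -v = 1 + -(v + 1) by ring, Real.rpow_add ht, Real.rpow_one]
    have hv : 1 - v ≠ 0 := by linarith
    rw [show 1 - v - 1 = -v by ring, show -v - 1 = -(v + 1) by ring, e]
    simp only [id]
    field_simp
    ring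
  have hmono : MonotoneOn P (Set.Icc m (m + 1)) := by
    refine monotoneOn_of_deriv_nonneg (convex_Icc _ _)
      (fun t ht => (hd t (hm.trans_le ht.1)).continuousAt.continuousWithinAt)
      (fun t ht => ?_) (fun t ht => ?_)
    · rw [interior_Icc] at ht
      exact (hd t (hm.trans ht.1)).differentiableAt.differentiableWithinAt
    · rw [interior_Icc] at ht
      rw [(hd t (hm.trans ht.1)).deriv]
      exact mul_nonneg (by linarith [ht.1]) (sub_nonneg.2 (Real.rpow_le_rpow_of_nonpos
        (hm.trans ht.1) ht.2.le (by linarith)))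
  have key := hmono (Set.left_mem_Icc.2 (by linarith)) (Set.right_mem_Icc.2 (by linarith))
    (by linarith : m ≤ m + 1)
  simp only [hP] at key
  have e1 : m ^ (1 - v) = m * m ^ (-v) := by
    rw [sub_eq_add_neg, Real.rpow_add hm, Real.rpow_one]
  have hm1 : 0 < m + 1 := by linarith
  have e2 : (m + 1) ^ (1 - v) = (m + 1) * (m + 1) ^ (-v) := by
    rw [sub_eq_add_neg, Real.rpow_add hm1, Real.rpow_one]
  have hv : 0 < 1 - v := by linarith
  have e3 : 1 / (v * (1 - v)) = 1 / (1 - v) + 1 / v := by field_simp; ring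
  rw [div_eq_mul_one_div _ (v * (1 - v)), e3]
  rw [e1, e2] at key ⊢
  simp only [sub_self, ne_eq, OfNat.ofNat_ne_zero, not_false_eq_true, zero_pow, mul_zero, zero_div,
    sub_zero, add_sub_cancel_left, one_pow, mul_one] at key
  have hv2 := hv.ne'
  have hv3 := hv0.ne'
  generalize (m + 1) ^ (-v) = B at *
  generalize m ^ (-v) = A at *
  generalize (m + 1) ^ (-(v + 1)) = D at *
  have k1 : m * A / (1 - v) + m * A / v ≤ (m + 1) * B / (1 - v) + m * B / v - D / 2 := key
  have : A / v - ((m + 1) * B - m * A) * (1 / (1 - v) + 1 / v) - ((A - B) / v - D / 2)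
      = m * A / (1 - v) + m * A / v - ((m + 1) * B / (1 - v) + m * B / v - D / 2) := by
    field_simp
    ring
  linarith

lemma hasSum_telescope_rpow_neg {v : ℝ} (hv : 0 < v) :
    HasSum (fun n : ℕ => (n + 1 : ℝ) ^ (-v) - (n + 2 : ℝ) ^ (-v)) 1 := by
  have hlim : Tendsto (fun N : ℕ => (N + 1 : ℝ) ^ (-v)) atTop (𝓝 0) := by
    have h := (tendsto_rpow_neg_atTop hv).comp
      (tendsto_natCast_atTop_atTop.comp (tendsto_add_atTop_nat 1) : Tendsto
        (fun N : ℕ => ((N + 1 : ℕ) : ℝ)) atTop atTop)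
    exact h.congr fun N => by simp
  rw [hasSum_iff_tendsto_nat_of_nonneg]
  · have : ∀ N : ℕ, ∑ n ∈ Finset.range N, ((n + 1 : ℝ) ^ (-v) - (n + 2 : ℝ) ^ (-v))
        = 1 - (N + 1 : ℝ) ^ (-v) := by
      intro N
      induction N with
      | zero => simp
      | succ N ih =>
        rw [Finset.sum_range_succ, ih]
        push_cast
        rw [show (N : ℝ) + 1 + 1 = N + 2 by ring]
        ring
    simp_rw [this]
    simpa using hlim.const_sub 1
  · intro n
    exact sub_nonneg.2 (Real.rpow_le_rpow_of_nonpos (by positivity) (by linarith) (by linarith))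

lemma zetaTerm_ofReal (v : ℝ) (n : ℕ) : zetaTerm v n =
    (((v - 1) * (n + 1 : ℝ) ^ (-v) + (n + 2 : ℝ) ^ (1 - v) - (n + 1 : ℝ) ^ (1 - v) : ℝ) : ℂ) := by
  rw [zetaTerm]
  push_cast [Complex.ofReal_cpow (by positivity : (0 : ℝ) ≤ n + 1),
    Complex.ofReal_cpow (by positivity : (0 : ℝ) ≤ n + 2)]
  rfl

/-- This is the expansion of (v - 1)ζ(v) - 1 multiplied by -1/(v(1 - v)), a form suited to termwise
comparison with `rpow_integral_comparison`. -/
lemma hasSum_riemannZeta_ofReal_of_lt_one {v : ℝ} (hv0 : 0 < v) (hv1 : v < 1) :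
    HasSum (fun n : ℕ => (n + 1 : ℝ) ^ (-v) / v -
      ((n + 2 : ℝ) ^ (1 - v) - (n + 1 : ℝ) ^ (1 - v)) / (v * (1 - v)))
      ((riemannZeta v).re / v + 1 / (v * (1 - v))) := by
  have hs : 0 < (v : ℂ).re := by simpa using hv0
  have hne : (v : ℂ) ≠ 1 := by exact_mod_cast hv1.ne
  have h := (summable_zetaTerm hs).hasSum
  have hre := Complex.hasSum_re h
  have htsum : ∑' n, zetaTerm v n = (v - 1) * riemannZeta v - 1 := by
    have h1 := riemannZeta₁_eq_tsum hs
    rw [riemannZeta_eq_inv_sub_mul hne, h1]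
    have := sub_ne_zero.2 hne
    field_simp
    ring
  rw [htsum, show ((v : ℂ) - 1) * riemannZeta v - 1 = ((v - 1 : ℝ) : ℂ) * riemannZeta v - 1 by
    push_cast; rfl, Complex.sub_re, Complex.re_ofReal_mul, Complex.one_re] at hre
  have h2 := hre.mul_left (-1 / (v * (1 - v)))
  have h3 : 1 - v ≠ 0 := by linarith
  have h4 := hv0.ne'
  convert! h2 using 1
  · ext n
    rw [zetaTerm_ofReal, Complex.ofReal_re]
    field_simp
    ring
  · field_simp
    ring

lemma hasSum_riemannZeta_ofReal_of_one_lt {u : ℝ} (hu : 1 < u) :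
    HasSum (fun n : ℕ => (n + 1 : ℝ) ^ (-u)) (riemannZeta u).re := by
  have hz := zeta_eq_tsum_one_div_nat_add_one_cpow (s := u) (by simpa using hu)
  have h1 : ∀ n : ℕ, 1 / ((n : ℂ) + 1) ^ (u : ℂ) = (((n + 1 : ℝ) ^ (-u) : ℝ) : ℂ) := by
    intro n
    rw [Complex.ofReal_cpow (by positivity)]
    push_cast
    rw [Complex.cpow_neg, one_div]
  simp_rw [h1] at hz
  rw [hz, ← Complex.ofReal_tsum, Complex.ofReal_re]
  exact (summable_nat_add_one_rpow_neg hu).hasSum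

/-- As v → 0 the two summands behave like 1/(2v) and -1/(2v), so they must be estimated together.
Summing `rpow_integral_comparison` over m = n + 1 does this: the telescoping part gives 1/v, which
cancels against 1/(v(1 - v)) and leaves -1/(1 - v). -/
lemma riemannZeta_half_add_le {v : ℝ} (hv0 : 0 < v) (hv1 : v < 1) :
    (riemannZeta (v + 1 : ℝ)).re / 2 + (riemannZeta v).re / v ≤ 1 / 2 - 1 / (1 - v) := by
  have h1 := hasSum_riemannZeta_ofReal_of_lt_one hv0 hv1
  have h2 := hasSum_riemannZeta_ofReal_of_one_lt (by linarith : 1 < v + 1)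
  have h3 := (hasSum_telescope_rpow_neg hv0).div_const v
  have h4 : HasSum (fun n : ℕ => (n + 2 : ℝ) ^ (-(v + 1))) ((riemannZeta (v + 1 : ℝ)).re - 1) := by
    have := (hasSum_nat_add_iff' 1).2 h2
    simp only [Finset.range_one, Finset.sum_singleton, CharP.cast_eq_zero, zero_add,
      Real.one_rpow] at this
    convert! this using 3 with n
    push_cast
    ring
  have hle := hasSum_le (fun n => ?_) h1 (h3.sub (h4.div_const 2))
  · have h5 : 1 / (v * (1 - v)) = 1 / (1 - v) + 1 / v := by
      have : 1 - v ≠ 0 := by linarith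
      field_simp; ring
    linarith
  · have := rpow_integral_comparison hv0 hv1 (by positivity : (0 : ℝ) < n + 1)
    rwa [show (n + 1 + 1 : ℝ) = n + 2 by ring] at this

/-- At v = 2σ - 1 the upper bound reads 1/2 - 1/(2(1 - σ)). It is negative, so the absolute value is
at least 1/(2(1 - σ)) - 1/2, and σ > 1/2 lets half of the first term absorb the 1/2. -/
lemma inv_le_zetaBound {σ : ℝ} (h1 : 1 / 2 < σ) (h2 : σ < 1) :
    1 / (4 * (1 - σ)) ≤ zetaBound σ := by
  have h := riemannZeta_half_add_le (v := 2 * σ - 1) (by linarith) (by linarith)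
  have e : (riemannZeta (2 * (σ : ℂ)) / 2 + riemannZeta (2 * (σ : ℂ) - 1) / (2 * (σ : ℂ) - 1)).re
      = (riemannZeta ((2 * σ - 1 + 1 : ℝ) : ℂ)).re / 2 +
        (riemannZeta ((2 * σ - 1 : ℝ) : ℂ)).re / (2 * σ - 1) := by
    rw [Complex.add_re, show 2 * (σ : ℂ) - 1 = ((2 * σ - 1 : ℝ) : ℂ) by push_cast; rfl,
      Complex.div_ofReal_re, show (2 : ℂ) = ((2 : ℝ) : ℂ) by norm_num, Complex.div_ofReal_re]
    push_cast
    simp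
  rw [zetaBound]
  refine le_trans ?_ ((neg_le_abs _).trans (Complex.abs_re_le_norm _))
  rw [e]
  have h3 : 1 / (1 - (2 * σ - 1)) = 2 * (1 / (4 * (1 - σ))) := by
    have : 1 - σ ≠ 0 := by linarith
    rw [show 1 - (2 * σ - 1) = 2 * (1 - σ) by ring]
    field_simp; norm_num
  have h4 : 1 / 2 ≤ 1 / (4 * (1 - σ)) := by
    rw [div_le_div_iff₀ (by norm_num) (by linarith)]; linarith
  linarith

/-! ### Functional equation and convexity bound in the critical strip -/

lemma norm_Gamma_le_Gamma_re {s : ℂ} (hs : 0 < s.re) : ‖Complex.Gamma s‖ ≤ Real.Gamma s.re := by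
  rw [Complex.Gamma_eq_integral hs, Complex.GammaIntegral, Real.Gamma_eq_integral hs]
  refine (norm_integral_le_integral_norm _).trans (le_of_eq ?_)
  refine setIntegral_congr_fun measurableSet_Ioi fun x hx => ?_
  simp only [norm_mul]
  rw [Complex.norm_cpow_eq_rpow_re_of_pos hx]
  simp [Complex.norm_exp]

lemma norm_cos_le_exp_abs_im (z : ℂ) : ‖Complex.cos z‖ ≤ Real.exp |z.im| := by
  rw [Complex.cos, norm_div]
  have h1 : ‖Complex.exp (z * Complex.I)‖ ≤ Real.exp |z.im| := by
    rw [Complex.norm_exp]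
    simpa using neg_le_abs z.im
  have h2 : ‖Complex.exp (-z * Complex.I)‖ ≤ Real.exp |z.im| := by
    rw [Complex.norm_exp]
    simpa using le_abs_self z.im
  have := norm_add_le (Complex.exp (z * Complex.I)) (Complex.exp (-z * Complex.I))
  simp only [Complex.norm_ofNat]
  linarith

lemma norm_sin_mul_I_le_norm_cos_mul_I (a : ℝ) :
    ‖Complex.sin (a * Complex.I)‖ ≤ ‖Complex.cos (a * Complex.I)‖ := by
  rw [Complex.sin_mul_I, Complex.cos_mul_I, norm_mul, Complex.norm_I, mul_one,
    ← Complex.ofReal_sinh, ← Complex.ofReal_cosh, Complex.norm_real, Complex.norm_real,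
    Real.norm_eq_abs, Real.norm_eq_abs]
  refine sq_le_sq.1 ?_
  nlinarith [Real.cosh_sq a]

/-- Reflection at iy together with |Γ(1 - iy)| = |y||Γ(iy)| determines |Γ(1 - iy)|² exactly. The
cosine is sin(iπy/2), and the double angle formula leaves π|y|/2 times tanh(π|y|/2) ≤ 1. No Stirling
formula is needed. -/
lemma norm_Gamma_mul_cos_sq_le {y : ℝ} (hy : y ≠ 0) :
    ‖Complex.Gamma (1 - y * Complex.I) * Complex.cos (Real.pi * (1 - y * Complex.I) / 2)‖ ^ 2 ≤
      Real.pi * |y| / 2 := by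
  have hyI : (y : ℂ) * Complex.I ≠ 0 := by simp [hy]
  have hrefl := Complex.Gamma_mul_Gamma_one_sub (y * Complex.I)
  have hconj : ‖Complex.Gamma (1 - y * Complex.I)‖ = |y| * ‖Complex.Gamma (y * Complex.I)‖ := by
    have h1 := Complex.Gamma_conj (1 + y * Complex.I)
    have h2 : (starRingEnd ℂ) (1 + y * Complex.I) = 1 - y * Complex.I := by
      simp [sub_eq_add_neg]
    rw [h2] at h1
    rw [h1, RCLike.norm_conj, add_comm, Complex.Gamma_add_one _ hyI]
    simp
  have hcos : Complex.cos (Real.pi * (1 - y * Complex.I) / 2) =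
      Complex.sin ((Real.pi * y / 2 : ℝ) * Complex.I) := by
    rw [← Complex.cos_pi_div_two_sub]
    congr 1
    push_cast
    ring
  have hsin : Complex.sin (Real.pi * (y * Complex.I)) =
      2 * Complex.sin ((Real.pi * y / 2 : ℝ) * Complex.I) *
        Complex.cos ((Real.pi * y / 2 : ℝ) * Complex.I) := by
    rw [← Complex.sin_two_mul]
    congr 1
    push_cast
    ring
  have hle := norm_sin_mul_I_le_norm_cos_mul_I (Real.pi * y / 2)
  rw [hsin] at hrefl
  rw [hcos, norm_mul, mul_pow]
  have hn := congrArg norm hrefl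
  simp only [norm_mul, norm_div, Complex.norm_ofNat, Complex.norm_real, Real.norm_eq_abs,
    abs_of_pos Real.pi_pos] at hn
  have hcpos : 0 < ‖Complex.cos ((Real.pi * y / 2 : ℝ) * Complex.I)‖ := by
    rw [Complex.cos_mul_I, ← Complex.ofReal_cosh, Complex.norm_real]
    exact norm_pos_iff.2 (Real.cosh_pos _).ne'
  have hspos : 0 < ‖Complex.sin ((Real.pi * y / 2 : ℝ) * Complex.I)‖ := by
    rw [Complex.sin_mul_I, norm_mul, Complex.norm_I, mul_one, ← Complex.ofReal_sinh,
      Complex.norm_real]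
    refine norm_pos_iff.2 (Real.sinh_ne_zero.2 ?_)
    exact div_ne_zero (mul_ne_zero Real.pi_ne_zero hy) two_ne_zero
  set S := ‖Complex.sin ((Real.pi * y / 2 : ℝ) * Complex.I)‖
  set Co := ‖Complex.cos ((Real.pi * y / 2 : ℝ) * Complex.I)‖
  have h3 : ‖Complex.Gamma (1 - y * Complex.I)‖ ^ 2 = |y| * (Real.pi / (2 * S * Co)) := by
    rw [← hn, sq]
    nth_rewrite 1 [hconj]
    ring
  rw [h3, show |y| * (Real.pi / (2 * S * Co)) * S ^ 2 = Real.pi * |y| / 2 * (S / Co) by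
    field_simp]
  have : S / Co ≤ 1 := (div_le_one hcpos).2 hle
  have h4 : 0 ≤ Real.pi * |y| / 2 := by positivity
  nlinarith

lemma norm_riemannZeta_mul_I_sq_le {y : ℝ} (hy : y ≠ 0) :
    ‖riemannZeta (y * Complex.I)‖ ^ 2 ≤ |y| * ‖riemannZeta (1 - y * Complex.I)‖ ^ 2 := by
  have h := riemannZeta_one_sub (s := 1 - y * Complex.I) (fun n h => by
    have := congrArg Complex.re h
    simp at this
    have h2 : (0 : ℝ) ≤ n := n.cast_nonneg
    linarith) (fun h => by
    have := congrArg Complex.im h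
    simp at this
    exact hy this)
  rw [sub_sub_cancel] at h
  have h2 : ‖(2 * (2 * Real.pi : ℂ) ^ (-(1 - y * Complex.I)))‖ = Real.pi⁻¹ := by
    rw [norm_mul, show (2 * Real.pi : ℂ) = ((2 * Real.pi : ℝ) : ℂ) by push_cast; rfl,
      Complex.norm_cpow_eq_rpow_re_of_pos (by positivity)]
    simp [Real.rpow_neg_one]
    field_simp
  rw [h, mul_assoc (2 * _) (Complex.Gamma _), norm_mul, norm_mul, h2, mul_pow, mul_pow]
  have h3 := norm_Gamma_mul_cos_sq_le hy
  gcongr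
  calc _ ≤ Real.pi⁻¹ ^ 2 * (Real.pi * |y| / 2) := by gcongr
    _ = |y| * (1 / (2 * Real.pi)) := by field_simp
    _ ≤ |y| * 1 := by
        gcongr
        rw [div_le_one (by positivity)]
        linarith [Real.pi_gt_three]
    _ = |y| := mul_one _

lemma norm_le_one_add_abs_im {s : ℂ} (h0 : 0 ≤ s.re) (h1 : s.re ≤ 1) : ‖s‖ ≤ 1 + |s.im| := by
  refine (Complex.norm_le_abs_re_add_abs_im s).trans ?_
  rw [abs_of_nonneg h0]
  linarith

lemma norm_sub_one_le_one_add_abs_im {s : ℂ} (h0 : 0 ≤ s.re) (h1 : s.re ≤ 1) :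
    ‖s - 1‖ ≤ 1 + |s.im| := by
  refine (Complex.norm_le_abs_re_add_abs_im _).trans ?_
  simp only [Complex.sub_re, Complex.one_re, Complex.sub_im, Complex.one_im, sub_zero]
  rw [abs_of_nonpos (by linarith)]
  linarith

/-- A bound on the part `|Im s| ≤ 1` of the closed critical strip. -/
lemma exists_norm_riemannZeta₁_le_of_abs_im_le_one :
    ∃ K : ℝ, 0 < K ∧ ∀ s : ℂ, 0 ≤ s.re → s.re ≤ 1 → |s.im| ≤ 1 → ‖riemannZeta₁ s‖ ≤ K := by
  obtain ⟨K, hK⟩ := (isCompact_closedBall (0 : ℂ) 2).exists_bound_of_continuousOn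
    differentiable_riemannZeta₁.continuous.continuousOn
  refine ⟨max K 1, by positivity, fun s h0 h1 h2 => (hK s ?_).trans (le_max_left _ _)⟩
  simpa using (norm_le_one_add_abs_im h0 h1).trans (by linarith)

lemma exists_norm_riemannZeta₁_one_line_le {ε : ℝ} (h0 : 0 < ε) (h1 : ε ≤ 1) :
    ∃ K : ℝ, 0 < K ∧ ∀ s : ℂ, s.re = 1 → ‖riemannZeta₁ s‖ ≤ K * (1 + |s.im|) ^ (1 + ε) := by
  obtain ⟨K, hK, h⟩ := exists_norm_riemannZeta₁_le h0.le h1 (by linarith : 1 < 1 + ε)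
  refine ⟨1 + K, by positivity, fun s hs => (h s (by linarith) (by linarith)).trans ?_⟩
  have hb : 1 ≤ 1 + |s.im| := by linarith [abs_nonneg s.im]
  have h2 := norm_le_one_add_abs_im (s := s) (by linarith) (by linarith)
  have h3 := norm_sub_one_le_one_add_abs_im (s := s) (by linarith) (by linarith)
  calc 1 + K * ‖s - 1‖ * ‖s‖ ^ ε ≤ 1 + K * (1 + |s.im|) * (1 + |s.im|) ^ ε := by gcongr
    _ = 1 + K * (1 + |s.im|) ^ (1 + ε) := by
        rw [Real.rpow_add (by linarith), Real.rpow_one]; ring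
    _ ≤ (1 + |s.im|) ^ (1 + ε) + K * (1 + |s.im|) ^ (1 + ε) := by
        gcongr
        exact Real.one_le_rpow hb (by linarith)
    _ = _ := by ring

/-- The functional equation carries the bound from Re s = 1 at the cost of a factor |y|^(1/2).
Dividing by |y| is harmless for |y| ≥ 1; compactness covers the rest. -/
lemma exists_norm_riemannZeta₁_zero_line_le {ε : ℝ} (h0 : 0 < ε) (h1 : ε ≤ 1) :
    ∃ K : ℝ, 0 < K ∧ ∀ s : ℂ, s.re = 0 → ‖riemannZeta₁ s‖ ≤ K * (1 + |s.im|) ^ (3 / 2 + ε) := by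
  obtain ⟨K, hK, h⟩ := exists_norm_riemannZeta₁_one_line_le h0 h1
  obtain ⟨K', hK', h'⟩ := exists_norm_riemannZeta₁_le_of_abs_im_le_one
  refine ⟨max (2 * K) K', by positivity, fun s hs => ?_⟩
  have hb : 1 ≤ 1 + |s.im| := by linarith [abs_nonneg s.im]
  rcases le_total |s.im| 1 with hy | hy
  · refine (h' s hs.ge (by linarith) hy).trans ?_
    calc K' ≤ max (2 * K) K' * 1 := by simp
      _ ≤ _ := by
        gcongr
        exact Real.one_le_rpow hb (by linarith)
  · set y := s.im with hydef
    have hy0 : y ≠ 0 := by rintro h; rw [h] at hy; norm_num at hy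
    have hsy : s = y * Complex.I := by
      apply Complex.ext <;> simp [hs, hydef]
    have hne : s ≠ 1 := by rintro rfl; simp at hs
    have hne' : 1 - (y : ℂ) * Complex.I ≠ 1 := by simp [hy0]
    have hone := h (1 - y * Complex.I) (by simp)
    simp only [Complex.sub_im, Complex.one_im, Complex.mul_im, Complex.ofReal_re, Complex.I_im,
      mul_one, Complex.ofReal_im, Complex.I_re, mul_zero, add_zero, zero_sub, abs_neg] at hone
    have hf := norm_riemannZeta_mul_I_sq_le hy0
    have hsn : ‖1 - s - 1‖ = |y| := by
      rw [show 1 - s - 1 = -s by ring, norm_neg, hsy]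
      simp
    rw [← hsy] at hf hne' hone
    rw [riemannZeta_eq_inv_sub_mul hne, riemannZeta_eq_inv_sub_mul hne', norm_mul, norm_mul,
      norm_inv, norm_inv, hsn] at hf
    have hs1 : 0 < ‖s - 1‖ := norm_pos_iff.2 (sub_ne_zero.2 hne)
    have hs2 := norm_sub_one_le_one_add_abs_im (s := s) hs.ge (by linarith)
    rw [← hydef] at hs2
    have hyp : 0 < |y| := abs_pos.2 hy0
    set A := ‖riemannZeta₁ s‖
    set B := ‖riemannZeta₁ (1 - s)‖
    have h5 : A ^ 2 ≤ (1 + |y|) ^ 2 * (2 / (1 + |y|)) * (K * (1 + |y|) ^ (1 + ε)) ^ 2 := by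
      calc A ^ 2 = ‖s - 1‖ ^ 2 * (‖s - 1‖⁻¹ * A) ^ 2 := by field_simp
        _ ≤ ‖s - 1‖ ^ 2 * (|y| * (|y|⁻¹ * B) ^ 2) := by gcongr
        _ = ‖s - 1‖ ^ 2 * (1 / |y|) * B ^ 2 := by field_simp
        _ ≤ _ := by
          have hinv : 1 / |y| ≤ 2 / (1 + |y|) := by
            rw [div_le_div_iff₀ hyp (by linarith)]
            linarith
          gcongr ?_ ^ 2 * ?_ * ?_ ^ 2
    refine (pow_le_pow_iff_left₀ (norm_nonneg _) (by positivity) two_ne_zero).1 ?_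
    refine h5.trans ?_
    have e1 : (1 + |y|) ^ (3 / 2 + ε) = (1 + |y|) ^ (1 + ε) * (1 + |y|) ^ (1 / 2 : ℝ) := by
      rw [← Real.rpow_add (by linarith)]; congr 1; ring
    have e2 : ((1 + |y|) ^ (1 / 2 : ℝ)) ^ 2 = 1 + |y| := by
      rw [← Real.rpow_natCast, ← Real.rpow_mul (by linarith)]; norm_num
    rw [e1, mul_pow _ (_ * _), mul_pow ((1 + |y|) ^ (1 + ε)), e2, mul_pow K]
    have h6 : 2 * K ^ 2 ≤ (max (2 * K) K') ^ 2 := by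
      calc 2 * K ^ 2 ≤ (2 * K) ^ 2 := by nlinarith
        _ ≤ _ := by gcongr; exact le_max_left _ _
    calc _ = 2 * K ^ 2 * (((1 + |y|) ^ (1 + ε)) ^ 2 * (1 + |y|)) := by
          field_simp
      _ ≤ _ := by gcongr

/-- Exponential growth of `(s - 1) ζ(s)` on the right half of the critical strip. -/
lemma exists_norm_riemannZeta₁_right_le_exp :
    ∃ K : ℝ, 0 < K ∧ ∀ s : ℂ, 1 / 2 ≤ s.re → s.re ≤ 1 →
      ‖riemannZeta₁ s‖ ≤ K * Real.exp (2 * |s.im|) := by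
  obtain ⟨K, hK, h⟩ := exists_norm_riemannZeta₁_le zero_le_one le_rfl (by norm_num : 1 < (3 / 2 : ℝ))
  refine ⟨1 + K, by positivity, fun s h0 h1 => (h s (by linarith) (by linarith)).trans ?_⟩
  have h2 := norm_le_one_add_abs_im (s := s) (by linarith) (by linarith)
  have h3 := norm_sub_one_le_one_add_abs_im (s := s) (by linarith) (by linarith)
  have h4 : 1 + |s.im| ≤ Real.exp |s.im| := by
    have := Real.add_one_le_exp |s.im|
    linarith
  have h5 : Real.exp (2 * |s.im|) = Real.exp |s.im| * Real.exp |s.im| := by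
    rw [← Real.exp_add]; ring_nf
  rw [Real.rpow_one]
  calc 1 + K * ‖s - 1‖ * ‖s‖ ≤ 1 + K * Real.exp |s.im| * Real.exp |s.im| := by
        gcongr <;> linarith
    _ = 1 + K * Real.exp (2 * |s.im|) := by rw [h5]; ring
    _ ≤ Real.exp (2 * |s.im|) + K * Real.exp (2 * |s.im|) := by
        gcongr
        exact Real.one_le_exp (by positivity)
    _ = _ := by ring

/-- Exponential growth of `(s - 1) ζ(s)` on the closed critical strip. -/
lemma exists_norm_riemannZeta₁_le_exp :
    ∃ K : ℝ, 0 < K ∧ ∀ s : ℂ, 0 ≤ s.re → s.re ≤ 1 →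
      ‖riemannZeta₁ s‖ ≤ K * Real.exp (5 * |s.im|) := by
  obtain ⟨K₁, hK₁, hr⟩ := exists_norm_riemannZeta₁_right_le_exp
  obtain ⟨K₂, hK₂, hc⟩ := exists_norm_riemannZeta₁_le_of_abs_im_le_one
  obtain ⟨G, hG⟩ := (isCompact_Icc (a := (1 / 2 : ℝ)) (b := 1)).exists_bound_of_continuousOn
    (f := Real.Gamma) (fun x hx => (Real.differentiableAt_Gamma (fun m hm => by
      have h1 := hx.1
      have h2 : (0 : ℝ) ≤ m := m.cast_nonneg
      linarith)).continuousAt.continuousWithinAt)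
  have hG0 : 0 ≤ G := (norm_nonneg _).trans (hG 1 (by norm_num))
  refine ⟨max (max K₁ K₂) (2 * G * K₁), by positivity, fun s h0 h1 => ?_⟩
  have hexp : 1 ≤ Real.exp (5 * |s.im|) := Real.one_le_exp (by positivity)
  rcases le_total (1 / 2) s.re with h2 | h2
  · refine (hr s h2 h1).trans ?_
    gcongr
    · exact (le_max_left _ _).trans (le_max_left _ _)
    · norm_num
  rcases le_total |s.im| 1 with h3 | h3
  · refine (hc s h0 h1 h3).trans ?_
    calc K₂ ≤ max (max K₁ K₂) (2 * G * K₁) * 1 := by simp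
      _ ≤ _ := by gcongr
  · have him : s.im ≠ 0 := by rintro h; rw [h] at h3; norm_num at h3
    have hf := riemannZeta_one_sub (s := 1 - s) (fun n h => by
      have := congrArg Complex.im h
      simp at this
      exact him this) (fun h => by
      have := congrArg Complex.im h
      simp at this
      exact him this)
    have hne : s ≠ 1 := by rintro rfl; simp at him
    have hne' : 1 - s ≠ 1 := fun h => by
      have := congrArg Complex.im h
      simp at this
      exact him this
    rw [sub_sub_cancel, riemannZeta_eq_inv_sub_mul hne, riemannZeta_eq_inv_sub_mul hne',
      show 1 - s - 1 = -s by ring] at hf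
    have hs1 := norm_sub_one_le_one_add_abs_im h0 h1
    have hf2 : riemannZeta₁ s = (s - 1) * ((2 * (2 * Real.pi : ℂ) ^ (-(1 - s))) *
        Complex.Gamma (1 - s) * Complex.cos (Real.pi * (1 - s) / 2) *
          ((-s)⁻¹ * riemannZeta₁ (1 - s))) := by
      rw [← hf]
      have := sub_ne_zero.2 hne
      field_simp
    have b1 : ‖2 * (2 * Real.pi : ℂ) ^ (-(1 - s))‖ ≤ 2 := by
      rw [norm_mul, show (2 * Real.pi : ℂ) = ((2 * Real.pi : ℝ) : ℂ) by push_cast; rfl,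
        Complex.norm_cpow_eq_rpow_re_of_pos (by positivity)]
      have := Real.rpow_le_one_of_one_le_of_nonpos (x := 2 * Real.pi) (z := (-(1 - s)).re)
        (by linarith [Real.pi_gt_three]) (by simp; linarith)
      simp only [Complex.norm_ofNat]
      linarith
    have b2 : ‖Complex.Gamma (1 - s)‖ ≤ G := by
      refine (norm_Gamma_le_Gamma_re (by simp; linarith)).trans ((le_abs_self _).trans (hG _ ?_))
      simp only [Complex.sub_re, Complex.one_re, Set.mem_Icc]
      constructor <;> linarith
    have b3 : ‖Complex.cos (Real.pi * (1 - s) / 2)‖ ≤ Real.exp (2 * |s.im|) := by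
      refine (norm_cos_le_exp_abs_im _).trans (Real.exp_le_exp.2 ?_)
      have : (Real.pi * (1 - s) / 2 : ℂ) = ((Real.pi / 2 : ℝ) : ℂ) * (1 - s) := by
        push_cast; ring
      rw [this, Complex.im_ofReal_mul, abs_mul, abs_of_pos (by positivity)]
      simp only [Complex.sub_im, Complex.one_im, zero_sub, abs_neg]
      gcongr
      linarith [Real.pi_le_four]
    have b4 : ‖(-s)⁻¹‖ ≤ 1 := by
      rw [norm_inv, norm_neg]
      exact inv_le_one_of_one_le₀ (h3.trans (Complex.abs_im_le_norm s))
    have b5 : ‖riemannZeta₁ (1 - s)‖ ≤ K₁ * Real.exp (2 * |s.im|) := by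
      simpa using hr (1 - s) (by simp; linarith) (by simpa using h0)
    have b6 : ‖s - 1‖ ≤ Real.exp |s.im| := by
      have := Real.add_one_le_exp |s.im|
      linarith
    rw [hf2]
    simp only [norm_mul] at b1 ⊢
    -- The rate 5 is 1 + 2 + 2, from s - 1, the cosine and the reflected value; any finite rate
    -- would do, as a Gaussian factor will dominate it.
    calc _ ≤ Real.exp |s.im| * (2 * G * Real.exp (2 * |s.im|) *
          (1 * (K₁ * Real.exp (2 * |s.im|)))) := by gcongr
      _ = 2 * G * K₁ * (Real.exp |s.im| * Real.exp (2 * |s.im|) * Real.exp (2 * |s.im|)) := by ring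
      _ = 2 * G * K₁ * Real.exp (5 * |s.im|) := by
          rw [← Real.exp_add, ← Real.exp_add]; ring_nf
      _ ≤ _ := by gcongr; exact le_max_right _ _

/-- This factor equals 1 at s = w and decays like a Gaussian in Im s, so it localises bounds in the
strip near the height of w. -/
lemma norm_exp_sub_sq_le {s w : ℂ} (h0 : 0 ≤ s.re) (h1 : s.re ≤ 1) (h0' : 0 ≤ w.re)
    (h1' : w.re ≤ 1) :
    ‖Complex.exp ((s - w) ^ 2)‖ ≤ Real.exp (1 - (s.im - w.im) ^ 2) := by
  rw [Complex.norm_exp]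
  refine Real.exp_le_exp.2 ?_
  simp only [sq, Complex.mul_re, Complex.sub_re, Complex.sub_im]
  nlinarith

/-- Localisation turns growth at height y into growth at height T: use 1 + |y| ≤ (1 + |T|)(1 + |y -
T|), then pu - u² ≤ p² for u = |y - T|. -/
lemma one_add_abs_rpow_mul_exp_le {p : ℝ} (hp : 0 ≤ p) (y T : ℝ) :
    (1 + |y|) ^ p * Real.exp (1 - (y - T) ^ 2) ≤ Real.exp (1 + p ^ 2) * (1 + |T|) ^ p := by
  have h1 : 1 + |y| ≤ (1 + |T|) * (1 + |y - T|) := by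
    have := abs_add_le T (y - T)
    rw [add_sub_cancel] at this
    nlinarith [abs_nonneg T, abs_nonneg (y - T)]
  have h2 : (1 + |y - T|) ^ p ≤ Real.exp (p * |y - T|) := by
    rw [mul_comm, Real.exp_mul]
    gcongr
    linarith [Real.add_one_le_exp |y - T|]
  calc (1 + |y|) ^ p * Real.exp (1 - (y - T) ^ 2)
      ≤ ((1 + |T|) * (1 + |y - T|)) ^ p * Real.exp (1 - (y - T) ^ 2) := by gcongr
    _ = (1 + |T|) ^ p * ((1 + |y - T|) ^ p * Real.exp (1 - (y - T) ^ 2)) := by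
        rw [Real.mul_rpow (by positivity) (by positivity)]; ring
    _ ≤ (1 + |T|) ^ p * (Real.exp (p * |y - T|) * Real.exp (1 - (y - T) ^ 2)) := by gcongr
    _ ≤ (1 + |T|) ^ p * Real.exp (1 + p ^ 2) := by
        gcongr
        rw [← Real.exp_add]
        refine Real.exp_le_exp.2 ?_
        nlinarith [sq_abs (y - T), sq_nonneg (p - |y - T|), sq_nonneg (p), sq_nonneg (|y - T|)]
    _ = _ := by ring

/-- Convexity bound for the Riemann zeta function on the critical strip. -/
theorem exists_norm_riemannZeta₁_le_convexity {ε : ℝ} (hε : 0 < ε) (hε1 : ε ≤ 1) :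
    ∃ K : ℝ, 0 < K ∧ ∀ s : ℂ, 0 ≤ s.re → s.re ≤ 1 →
      ‖riemannZeta₁ s‖ ≤ K * (1 + |s.im|) ^ (1 + ε + (1 - s.re) / 2) := by
  obtain ⟨A, hA, hleft⟩ := exists_norm_riemannZeta₁_zero_line_le hε hε1
  obtain ⟨B, hB, hright⟩ := exists_norm_riemannZeta₁_one_line_le hε hε1
  obtain ⟨G, hG, hstrip⟩ := exists_norm_riemannZeta₁_le_exp
  set M := max A B * Real.exp (1 + (3 / 2 + ε) ^ 2) with hM
  have hMpos : 0 < M := by positivity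
  refine ⟨M, hMpos, fun w hw0 hw1 => ?_⟩
  -- The Gaussian makes F bounded on the strip and its boundary bounds constants depending only on
  -- Im w, as the three lines theorem requires, while F(w) is the value sought.
  set F : ℂ → ℂ := fun s => riemannZeta₁ s * Complex.exp ((s - w) ^ 2) with hF
  have hFd : Differentiable ℂ F := by
    intro s
    simp only [hF]
    fun_prop
  have hl : ∀ z ∈ Complex.re ⁻¹' {(0 : ℝ)}, ‖F z‖ ≤ M * (1 + |w.im|) ^ (3 / 2 + ε) := by
    intro z hz
    have hz : z.re = 0 := hz
    simp only [hF, norm_mul]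
    calc _ ≤ A * (1 + |z.im|) ^ (3 / 2 + ε) * Real.exp (1 - (z.im - w.im) ^ 2) := by
          gcongr
          · exact hleft z hz
          · exact norm_exp_sub_sq_le hz.ge (by linarith) hw0 hw1
      _ = A * ((1 + |z.im|) ^ (3 / 2 + ε) * Real.exp (1 - (z.im - w.im) ^ 2)) := by ring
      _ ≤ max A B * (Real.exp (1 + (3 / 2 + ε) ^ 2) * (1 + |w.im|) ^ (3 / 2 + ε)) := by
          exact mul_le_mul (le_max_left _ _) (one_add_abs_rpow_mul_exp_le (by linarith) _ _)
            (by positivity) (by positivity)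
      _ = _ := by rw [hM]; ring
  have hr : ∀ z ∈ Complex.re ⁻¹' {(1 : ℝ)}, ‖F z‖ ≤ M * (1 + |w.im|) ^ (1 + ε) := by
    intro z hz
    have hz : z.re = 1 := hz
    simp only [hF, norm_mul]
    calc _ ≤ B * (1 + |z.im|) ^ (1 + ε) * Real.exp (1 - (z.im - w.im) ^ 2) := by
          gcongr
          · exact hright z hz
          · exact norm_exp_sub_sq_le (by linarith) hz.le hw0 hw1
      _ = B * ((1 + |z.im|) ^ (1 + ε) * Real.exp (1 - (z.im - w.im) ^ 2)) := by ring
      _ ≤ max A B * (Real.exp (1 + (1 + ε) ^ 2) * (1 + |w.im|) ^ (1 + ε)) := by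
          exact mul_le_mul (le_max_right _ _) (one_add_abs_rpow_mul_exp_le (by linarith) _ _)
            (by positivity) (by positivity)
      _ ≤ max A B * (Real.exp (1 + (3 / 2 + ε) ^ 2) * (1 + |w.im|) ^ (1 + ε)) := by
          gcongr
          norm_num
      _ = _ := by rw [hM]; ring
  have hbdd : BddAbove ((norm ∘ F) '' Complex.HadamardThreeLines.verticalClosedStrip 0 1) := by
    -- With u = |Im z - Im w|, the exponent is at most 5|Im w| + 5u + 1 - u², and 5u + 1 - u² ≤ 29/4
    -- < 26.
    refine ⟨G * (Real.exp (5 * |w.im|) * Real.exp 26), ?_⟩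
    rintro _ ⟨z, hz, rfl⟩
    simp only [hF, Function.comp, norm_mul]
    calc _ ≤ G * Real.exp (5 * |z.im|) * Real.exp (1 - (z.im - w.im) ^ 2) := by
          gcongr
          · exact hstrip z hz.1 hz.2
          · exact norm_exp_sub_sq_le hz.1 hz.2 hw0 hw1
      _ = G * Real.exp (5 * |z.im| + (1 - (z.im - w.im) ^ 2)) := by rw [Real.exp_add]; ring
      _ ≤ _ := by
          rw [← Real.exp_add]
          refine mul_le_mul_of_nonneg_left (Real.exp_le_exp.2 ?_) hG.le
          have := abs_add_le w.im (z.im - w.im)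
          rw [add_sub_cancel] at this
          nlinarith [sq_abs (z.im - w.im), sq_nonneg (|z.im - w.im| - 5 / 2)]
  have key := Complex.HadamardThreeLines.norm_le_interp_of_mem_verticalClosedStrip₀₁' F
    (z := w) ⟨hw0, hw1⟩ hFd.diffContOnCl hbdd hl hr
  have hb : 0 < 1 + |w.im| := by positivity
  calc ‖riemannZeta₁ w‖ = ‖F w‖ := by simp [hF]
    _ ≤ _ := key
    _ = (M ^ (1 - w.re) * M ^ w.re) * ((1 + |w.im|) ^ ((3 / 2 + ε) * (1 - w.re)) *
          (1 + |w.im|) ^ ((1 + ε) * w.re)) := by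
        rw [Real.mul_rpow hMpos.le (by positivity), Real.mul_rpow hMpos.le (by positivity),
          Real.rpow_mul hb.le, Real.rpow_mul hb.le]
        ring
    _ = _ := by
        rw [← Real.rpow_add hMpos, ← Real.rpow_add hb]
        congr 2
        · simp
        · ring

/-! ### Invariance of the Cauchy distribution -/

lemma measurable_boolMap (α β : ℝ) : Measurable (boolMap α β) := by
  unfold boolMap
  exact Measurable.ite (measurableSet_singleton β) measurable_const (by fun_prop)

instance isProbabilityMeasure_muAB (α β : ℝ) : IsProbabilityMeasure (muAB α β) := by
  unfold muAB; infer_instance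

lemma muAB_eq_withDensity {α : ℝ} (hα : 0 < α) (β : ℝ) :
    muAB α β = volume.withDensity (cauchyPDF β α.toNNReal) :=
  cauchyMeasure_of_scale_ne_zero _ (by simpa using hα)

lemma cauchyPDFReal_toNNReal {α : ℝ} (hα : 0 < α) (β x : ℝ) :
    cauchyPDFReal β α.toNNReal x = Real.pi⁻¹ * α * ((x - β) ^ 2 + α ^ 2)⁻¹ := by
  rw [cauchyPDFReal_def, Real.coe_toNNReal _ hα.le]

lemma muAB_Iic {α : ℝ} (hα : 0 < α) (β c : ℝ) :
    muAB α β (Set.Iic c) =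
      ENNReal.ofReal ((Real.arctan ((c - β) / α) + Real.pi / 2) / Real.pi) := by
  have hd : ∀ x ∈ Set.Iic c, HasDerivAt (fun x => Real.arctan ((x - β) / α) / Real.pi)
      (cauchyPDFReal β α.toNNReal x) x := by
    intro x _
    have h1 : HasDerivAt (fun x : ℝ => (x - β) / α) (1 / α) x :=
      ((hasDerivAt_id x).sub_const β).div_const α
    convert! h1.arctan.div_const Real.pi using 1
    rw [cauchyPDFReal_toNNReal hα]
    have : (x - β) ^ 2 + α ^ 2 ≠ 0 := by positivity
    have : 1 + ((x - β) / α) ^ 2 ≠ 0 := by positivity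
    field_simp
    ring
  have hlim : Tendsto (fun x => Real.arctan ((x - β) / α) / Real.pi) atBot
      (𝓝 (-(Real.pi / 2) / Real.pi)) := by
    refine Tendsto.div_const ?_ _
    refine (tendsto_nhds_of_tendsto_nhdsWithin Real.tendsto_arctan_atBot).comp ?_
    exact (tendsto_atBot_add_const_right _ (-β) tendsto_id).atBot_div_const hα
  have hint := integral_Iic_of_hasDerivAt_of_tendsto' hd
    (integrable_cauchyPDFReal β).integrableOn hlim
  have hnn : ∀ x, 0 ≤ cauchyPDFReal β α.toNNReal x := fun x =>
    (cauchyPDF_pos β (by simpa using hα) x).le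
  rw [muAB_eq_withDensity hα, withDensity_apply _ measurableSet_Iic]
  simp only [cauchyPDF]
  rw [← ofReal_integral_eq_lintegral_ofReal (integrable_cauchyPDFReal β).integrableOn
    (ae_of_all _ hnn), hint]
  congr 1
  ring

/-- T(x) - c is (x - (c - r))(x - (c + r)) / (2(x - β)), with r the square root in the statement.
Since c - r < β < c + r, the sign is read off on either side of β. -/
lemma boolMap_le_iff {α : ℝ} (hα : 0 < α) {β c x : ℝ} (hx : x ≠ β) :
    boolMap α β x ≤ c ↔
      x ≤ c - √((c - β) ^ 2 + α ^ 2) ∨ β < x ∧ x ≤ c + √((c - β) ^ 2 + α ^ 2) := by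
  set r := √((c - β) ^ 2 + α ^ 2) with hr
  have hr2 : r ^ 2 = (c - β) ^ 2 + α ^ 2 := Real.sq_sqrt (by positivity)
  have hr0 : 0 ≤ r := Real.sqrt_nonneg _
  have hrc : |c - β| < r := by
    rw [hr, ← Real.sqrt_sq_eq_abs]
    exact Real.sqrt_lt_sqrt (sq_nonneg _) (by nlinarith)
  obtain ⟨h1, h2⟩ := abs_lt.1 hrc
  have hxb : x - β ≠ 0 := sub_ne_zero.2 hx
  have hT : boolMap α β x - c = (x - (c - r)) * (x - (c + r)) / (2 * (x - β)) := by
    rw [boolMap, if_neg hx]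
    have : (x - (c - r)) * (x - (c + r)) = (x - c) ^ 2 - r ^ 2 := by ring
    rw [this, hr2]
    field_simp
    ring
  rw [← sub_nonpos, hT]
  rcases lt_or_gt_of_ne hx with h | h
  · rw [div_nonpos_iff]
    constructor
    · rintro (⟨h3, -⟩ | ⟨-, h3⟩)
      · left
        by_contra! h4
        nlinarith
      · linarith
    · rintro (h3 | ⟨h3, -⟩)
      · left
        exact ⟨mul_nonneg_of_nonpos_of_nonpos (by linarith) (by linarith), by linarith⟩
      · linarith
  · rw [div_nonpos_iff]
    constructor
    · rintro (⟨-, h3⟩ | ⟨h3, -⟩)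
      · linarith
      · right
        refine ⟨h, ?_⟩
        by_contra! h4
        nlinarith
    · rintro (h3 | ⟨-, h3⟩)
      · linarith
      · right
        exact ⟨mul_nonpos_of_nonneg_of_nonpos (by linarith) (by linarith), by linarith⟩

/-- The Cauchy distribution is invariant under the Boolean-type map. -/
theorem measurePreserving_boolMap {α : ℝ} (hα : 0 < α) (β : ℝ) :
    MeasurePreserving (boolMap α β) (muAB α β) (muAB α β) := by
  have hT := measurable_boolMap α β
  refine ⟨hT, ?_⟩
  have : IsFiniteMeasure ((muAB α β).map (boolMap α β)) := inferInstance
  refine Measure.ext_of_Iic _ _ fun c => ?_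
  rw [Measure.map_apply hT measurableSet_Iic]
  set r := √((c - β) ^ 2 + α ^ 2) with hr
  have hr2 : r ^ 2 = (c - β) ^ 2 + α ^ 2 := Real.sq_sqrt (by positivity)
  have hrc : |c - β| < r := by
    rw [hr, ← Real.sqrt_sq_eq_abs]
    exact Real.sqrt_lt_sqrt (sq_nonneg _) (by nlinarith)
  obtain ⟨h1, h2⟩ := abs_lt.1 hrc
  have hnull : muAB α β {β} = 0 := by
    rw [muAB_eq_withDensity hα]
    exact withDensity_absolutelyContinuous _ _ (by simp)
  have hae : boolMap α β ⁻¹' Set.Iic c =ᵐ[muAB α β]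
      (Set.Iic (c - r) ∪ Set.Ioc β (c + r) : Set ℝ) := by
    have hne : ∀ᵐ x ∂(muAB α β), x ≠ β := by
      rw [ae_iff]; simpa using hnull
    filter_upwards [hne] with x hx
    exact propext (boolMap_le_iff hα hx)
  have hmono : muAB α β (Set.Ioc β (c + r)) =
      ENNReal.ofReal (Real.arctan ((c + r - β) / α) / Real.pi) := by
    rw [← Set.Iic_sdiff_Iic, measure_sdiff (Set.Iic_subset_Iic.2 (by linarith))
      measurableSet_Iic.nullMeasurableSet (measure_ne_top _ _), muAB_Iic hα, muAB_Iic hα,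
      ← ENNReal.ofReal_sub]
    · congr 1
      simp
      ring
    · simp
      positivity
  rw [measure_congr hae, measure_union ?_ measurableSet_Ioc, hmono, muAB_Iic hα, muAB_Iic hα,
    ← ENNReal.ofReal_add]
  · congr 1
    -- The two normalised roots have product -1 and sum 2(c - β)/α, so the arctangent addition
    -- formula adds the masses of the two preimage pieces to the mass of (-∞, c].
    have hprod : (c - r - β) / α * ((c + r - β) / α) = -1 := by
      have : (c - r - β) * (c + r - β) = -α ^ 2 := by nlinarith
      field_simp
      linarith
    have hadd := Real.arctan_add (x := (c - r - β) / α) (y := (c + r - β) / α)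
      (by rw [hprod]; norm_num)
    rw [hprod] at hadd
    have : ((c - r - β) / α + (c + r - β) / α) / (1 - -1) = (c - β) / α := by
      field_simp
      ring
    rw [this] at hadd
    rw [← hadd]
    ring
  · have := Real.neg_pi_div_two_lt_arctan ((c - r - β) / α)
    exact div_nonneg (by linarith) Real.pi_pos.le
  · refine div_nonneg ?_ Real.pi_pos.le
    exact Real.arctan_nonneg.2 (div_nonneg (by linarith) hα.le)
  · refine Set.disjoint_left.2 fun x hx hx' => ?_
    have hx1 : x ≤ c - r := hx
    have hx2 : β < x := hx'.1
    linarith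

/-! ### Square variation of averages along a sequence -/

/-- The averages `(1/N) ∑_{n<N} f (T^{k n} x)` of `f` along the sequence `k`. -/
noncomputable def seqAvg {X : Type*} (T : X → X) (f : X → ℂ) (k : ℕ → ℕ) (N : ℕ) (x : X) : ℂ :=
  (1 / (N : ℂ)) * ∑ n ∈ Finset.range N, f (T^[k n] x)

section

variable {X : Type*} {T : X → X} {f : X → ℂ}

/-- An increment is the new term minus the old average, scaled by 1/(N + 2); this factor is the sole
source of convergence. The shift by one avoids the empty average. -/
lemma seqAvg_add_two_sub (T : X → X) (f : X → ℂ) (k : ℕ → ℕ) (N : ℕ) (x : X) :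
    seqAvg T f k (N + 2) x - seqAvg T f k (N + 1) x =
      (1 / (N + 2 : ℂ)) * (f (T^[k (N + 1)] x) - seqAvg T f k (N + 1) x) := by
  have h1 : (N + 1 : ℂ) ≠ 0 := by exact_mod_cast (Nat.succ_ne_zero N)
  have h2 : (N + 2 : ℂ) ≠ 0 := by exact_mod_cast (Nat.succ_ne_zero (N + 1))
  simp only [seqAvg]
  rw [Finset.sum_range_succ _ (N + 1)]
  push_cast
  field_simp
  ring

variable [MeasurableSpace X] {μ : Measure X}

lemma measurable_seqAvg (hT : Measurable T) (hf : Measurable f) (k : ℕ → ℕ) (N : ℕ) :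
    Measurable (seqAvg T f k N) := by
  unfold seqAvg
  exact (Finset.measurable_fun_sum _ fun n _ => hf.comp (hT.iterate (k n))).const_mul _

lemma eLpNorm_comp_iterate_eq (hT : MeasurePreserving T μ μ) (hf : Measurable f) (p : ℝ≥0∞)
    (n : ℕ) : eLpNorm (fun x => f (T^[n] x)) p μ = eLpNorm f p μ :=
  eLpNorm_comp_measurePreserving hf.aestronglyMeasurable (hT.iterate n)

lemma eLpNorm_seqAvg_le (hT : MeasurePreserving T μ μ) (hf : Measurable f) {p : ℝ≥0∞}
    (hp : 1 ≤ p) (k : ℕ → ℕ) (N : ℕ) :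
    eLpNorm (seqAvg T f k (N + 1)) p μ ≤ eLpNorm f p μ := by
  have e : seqAvg T f k (N + 1) =
      (1 / ((N + 1 : ℕ) : ℂ)) • ∑ n ∈ Finset.range (N + 1), fun x => f (T^[k n] x) := by
    ext x
    simp [seqAvg]
  rw [e, eLpNorm_const_smul]
  have h1 : eLpNorm (∑ n ∈ Finset.range (N + 1), fun x => f (T^[k n] x)) p μ ≤
      (N + 1 : ℕ) * eLpNorm f p μ := by
    refine (eLpNorm_sum_le (fun n _ =>
      (hf.comp (hT.measurable.iterate (k n))).aestronglyMeasurable) hp).trans (le_of_eq ?_)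
    refine (Finset.sum_congr rfl fun n _ => eLpNorm_comp_iterate_eq hT hf p (k n)).trans ?_
    simp
  have h2 : ‖(1 / ((N + 1 : ℕ) : ℂ))‖ₑ * ((N + 1 : ℕ) : ℝ≥0∞) = 1 := by
    have e' : ((N + 1 : ℕ) : ℝ≥0∞) = ‖((N + 1 : ℕ) : ℂ)‖ₑ := by
      rw [← ofReal_norm, Complex.norm_natCast, ENNReal.ofReal_natCast]
    rw [e', ← enorm_mul, one_div,
      inv_mul_cancel₀ (Nat.cast_ne_zero.2 (Nat.succ_ne_zero N)), enorm_one]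
  calc _ ≤ ‖(1 / ((N + 1 : ℕ) : ℂ))‖ₑ * ((N + 1 : ℕ) * eLpNorm f p μ) := by gcongr
    _ = _ := by rw [← mul_assoc, h2, one_mul]

lemma eLpNorm_sub_seqAvg_le (hT : MeasurePreserving T μ μ) (hf : Measurable f) {p : ℝ≥0∞}
    (hp : 1 ≤ p) (k : ℕ → ℕ) (N : ℕ) :
    eLpNorm (fun x => f (T^[k (N + 1)] x) - seqAvg T f k (N + 1) x) p μ ≤
      2 * eLpNorm f p μ := by
  refine (eLpNorm_sub_le (hf.comp (hT.measurable.iterate _)).aestronglyMeasurable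
    (measurable_seqAvg hT.measurable hf k _).aestronglyMeasurable hp).trans ?_
  rw [two_mul]
  exact add_le_add (eLpNorm_comp_iterate_eq hT hf p _).le (eLpNorm_seqAvg_le hT hf hp k N)

lemma tsum_enorm_one_div_sq_ne_top : ∑' N : ℕ, ‖(1 / (N + 2 : ℂ))‖ₑ ^ 2 ≠ ⊤ := by
  have h : Summable fun N : ℕ => ‖(1 / (N + 2 : ℂ))‖ ^ 2 := by
    have := (summable_nat_add_iff 2).2 (Real.summable_one_div_nat_pow.2 one_lt_two)
    refine this.congr fun N => ?_
    have e : (N + 2 : ℂ) = ((N + 2 : ℕ) : ℂ) := by push_cast; rfl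
    rw [e, norm_div, Complex.norm_natCast]
    simp
  have e : ∀ N : ℕ, ‖(1 / (N + 2 : ℂ))‖ₑ ^ 2 = ENNReal.ofReal (‖(1 / (N + 2 : ℂ))‖ ^ 2) := by
    intro N
    rw [ENNReal.ofReal_pow (norm_nonneg _), ofReal_norm]
  simp_rw [e]
  exact h.tsum_ofReal_ne_top

lemma tsum_eLpNorm_seqAvg_sub_sq_le (hT : MeasurePreserving T μ μ) (hf : Measurable f)
    {p : ℝ≥0∞} (hp : 1 ≤ p) (k : ℕ → ℕ) :
    ∑' N : ℕ, eLpNorm (fun x => seqAvg T f k (N + 2) x - seqAvg T f k (N + 1) x) p μ ^ 2 ≤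
      (∑' N : ℕ, ‖(1 / (N + 2 : ℂ))‖ₑ ^ 2) * (2 * eLpNorm f p μ) ^ 2 := by
  rw [← ENNReal.tsum_mul_right]
  refine ENNReal.tsum_le_tsum fun N => ?_
  simp_rw [seqAvg_add_two_sub]
  rw [← mul_pow]
  gcongr
  refine (eLpNorm_const_smul_le (c := (1 / (N + 2 : ℂ)))
    (f := fun x => f (T^[k (N + 1)] x) - seqAvg T f k (N + 1) x)).trans ?_
  gcongr
  exact eLpNorm_sub_seqAvg_le hT hf hp k N

/-- Weighted Cauchy-Schwarz inequality for series in `[0, ∞]`, up to a factor of `2`. -/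
lemma ENNReal.tsum_mul_sq_le {ι : Type*} (w g : ι → ℝ≥0∞) :
    (∑' i, w i * g i) ^ 2 ≤ 2 * (∑' i, w i) * ∑' i, w i * g i ^ 2 := by
  have hab : ∀ a b : ℝ≥0∞, a * b ≤ a ^ 2 + b ^ 2 := by
    intro a b
    rcases le_total a b with h | h
    · calc a * b ≤ b * b := by gcongr
        _ ≤ _ := by rw [← sq]; exact le_add_self
    · calc a * b ≤ a * a := by gcongr
        _ ≤ _ := by rw [← sq]; exact le_self_add
  calc (∑' i, w i * g i) ^ 2 = ∑' i, ∑' j, (w i * g i) * (w j * g j) := by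
        rw [sq, ← ENNReal.tsum_mul_right]
        simp_rw [ENNReal.tsum_mul_left]
    _ ≤ ∑' i, ∑' j, (w i * g i ^ 2 * w j + w i * (w j * g j ^ 2)) := by
        refine ENNReal.tsum_le_tsum fun i => ENNReal.tsum_le_tsum fun j => ?_
        calc (w i * g i) * (w j * g j) = w i * w j * (g i * g j) := by ring
          _ ≤ w i * w j * (g i ^ 2 + g j ^ 2) := by gcongr; exact hab _ _
          _ = _ := by ring
    _ = _ := by
        simp_rw [ENNReal.tsum_add, ENNReal.tsum_mul_left, ENNReal.tsum_mul_right]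
        ring

/-- Weighted Cauchy-Schwarz with weights |1/(N + 2)|² moves the outer square inside the sum. The
fourth moments that appear are bounded uniformly in N by 2⁴∫|f|⁴, and the weights are summable. -/
lemma lintegral_tsum_seqAvg_sub_sq_sq_le (hT : MeasurePreserving T μ μ) (hf : Measurable f)
    (k : ℕ → ℕ) :
    ∫⁻ x, (∑' N : ℕ, ‖seqAvg T f k (N + 2) x - seqAvg T f k (N + 1) x‖ₑ ^ 2) ^ 2 ∂μ ≤
      2 * (∑' N : ℕ, ‖(1 / (N + 2 : ℂ))‖ₑ ^ 2) ^ 2 * (16 * ∫⁻ x, ‖f x‖ₑ ^ 4 ∂μ) := by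
  set w : ℕ → ℝ≥0∞ := fun N => ‖(1 / (N + 2 : ℂ))‖ₑ ^ 2 with hw
  set h : ℕ → X → ℂ := fun N x => f (T^[k (N + 1)] x) - seqAvg T f k (N + 1) x with hh
  have hmeas : ∀ N, Measurable (h N) := fun N =>
    (hf.comp (hT.measurable.iterate _)).sub (measurable_seqAvg hT.measurable hf k _)
  have hfour : ∀ g : X → ℂ, ∫⁻ x, ‖g x‖ₑ ^ 4 ∂μ = eLpNorm g 4 μ ^ 4 := by
    intro g
    have := eLpNorm_nnreal_pow_eq_lintegral (μ := μ) (f := g) (p := 4) (by norm_num)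
    simp only [NNReal.coe_ofNat, ENNReal.coe_ofNat] at this
    exact_mod_cast this.symm
  have hint : ∀ N, ∫⁻ x, ‖h N x‖ₑ ^ 4 ∂μ ≤ 16 * ∫⁻ x, ‖f x‖ₑ ^ 4 ∂μ := by
    intro N
    rw [hfour, hfour]
    calc _ ≤ (2 * eLpNorm f 4 μ) ^ 4 := by
          gcongr
          exact eLpNorm_sub_seqAvg_le hT hf (by norm_num) k N
      _ = _ := by rw [mul_pow]; norm_num
  calc _ ≤ ∫⁻ x, 2 * (∑' N, w N) * ∑' N, w N * ‖h N x‖ₑ ^ 4 ∂μ := by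
        refine lintegral_mono fun x => ?_
        have e : ∀ N : ℕ, ‖seqAvg T f k (N + 2) x - seqAvg T f k (N + 1) x‖ₑ ^ 2 =
            w N * ‖h N x‖ₑ ^ 2 := by
          intro N
          rw [seqAvg_add_two_sub, enorm_mul, mul_pow]
        simp_rw [e]
        refine (ENNReal.tsum_mul_sq_le w _).trans (le_of_eq ?_)
        simp_rw [← pow_mul]
    _ = 2 * (∑' N, w N) * ∑' N, w N * ∫⁻ x, ‖h N x‖ₑ ^ 4 ∂μ := by
        rw [lintegral_const_mul _ (Measurable.tsum fun N =>
          ((hmeas N).enorm.pow_const 4).const_mul _), lintegral_tsum fun N =>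
          (((hmeas N).enorm.pow_const 4).const_mul _).aemeasurable]
        simp_rw [lintegral_const_mul _ ((hmeas _).enorm.pow_const 4)]
    _ ≤ 2 * (∑' N, w N) * ∑' N, w N * (16 * ∫⁻ x, ‖f x‖ₑ ^ 4 ∂μ) := by
        gcongr with N
        exact hint N
    _ = _ := by rw [ENNReal.tsum_mul_right]; ring

lemma mul_measure_le_tsum_seqAvg_sub_sq (hT : MeasurePreserving T μ μ) (hf : Measurable f)
    (k : ℕ → ℕ) (a : ℝ≥0∞) :
    a ^ 2 * μ {x | a ≤ ∑' N : ℕ, ‖seqAvg T f k (N + 2) x - seqAvg T f k (N + 1) x‖ₑ ^ 2} ≤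
      2 * (∑' N : ℕ, ‖(1 / (N + 2 : ℂ))‖ₑ ^ 2) ^ 2 * (16 * ∫⁻ x, ‖f x‖ₑ ^ 4 ∂μ) := by
  refine le_trans ?_ (lintegral_tsum_seqAvg_sub_sq_sq_le hT hf k)
  have hm : Measurable fun x => (∑' N : ℕ,
      ‖seqAvg T f k (N + 2) x - seqAvg T f k (N + 1) x‖ₑ ^ 2) ^ 2 :=
    (Measurable.tsum fun N => ((measurable_seqAvg hT.measurable hf k _).sub
      (measurable_seqAvg hT.measurable hf k _)).enorm.pow_const 2).pow_const 2
  refine le_trans ?_ (mul_meas_ge_le_lintegral hm (a ^ 2))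
  refine mul_le_mul_right (measure_mono fun x hx => ?_) _
  exact pow_le_pow_left' (Set.mem_ofPred.1 hx) 2

end

/-! ### Second and fourth moments of ζ on vertical lines -/

lemma measurable_riemannZeta : Measurable riemannZeta :=
  measurable_of_continuousOn_compl_singleton 1 differentiableOn_riemannZeta.continuousOn

lemma exists_cauchyPDFReal_le {α : ℝ} (hα : 0 < α) (β t : ℝ) :
    ∃ K : ℝ, 0 < K ∧ ∀ x, cauchyPDFReal β α.toNNReal x ≤ K * (1 + (x + t) ^ 2)⁻¹ := by
  -- The constant comes from (x + t)² ≤ 2(x - β)² + 2(β + t)².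
  refine ⟨Real.pi⁻¹ * α * (2 + (1 + 2 * (β + t) ^ 2) / α ^ 2), by positivity, fun x => ?_⟩
  rw [cauchyPDFReal_toNNReal hα, mul_assoc (_ * _) (_ + _)]
  gcongr
  rw [← div_eq_mul_inv, le_div_iff₀ (by positivity), inv_mul_le_iff₀ (by positivity)]
  have h : ((x - β) ^ 2 + α ^ 2) * (2 + (1 + 2 * (β + t) ^ 2) / α ^ 2) =
      2 * (x - β) ^ 2 + 2 * α ^ 2 + (1 + 2 * (β + t) ^ 2) +
        (x - β) ^ 2 * ((1 + 2 * (β + t) ^ 2) / α ^ 2) := by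
    field_simp
    ring
  rw [h]
  have : 0 ≤ (x - β) ^ 2 * ((1 + 2 * (β + t) ^ 2) / α ^ 2) := by positivity
  nlinarith [sq_nonneg (x - β - (β + t)), sq_nonneg α]

/-- Integrals against `muAB` are controlled by integrals against `(1 + y ^ 2)⁻¹`, after a
translation. -/
lemma exists_lintegral_muAB_le {α : ℝ} (hα : 0 < α) (β t : ℝ) :
    ∃ K : ℝ, 0 < K ∧ ∀ G : ℝ → ℝ, Measurable G → (∀ y, 0 ≤ G y) →
      ∫⁻ x, ENNReal.ofReal (G (x + t)) ∂(muAB α β) ≤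
        ∫⁻ y, ENNReal.ofReal (K * (G y * (1 + y ^ 2)⁻¹)) := by
  obtain ⟨K, hK, h⟩ := exists_cauchyPDFReal_le hα β t
  refine ⟨K, hK, fun G hG hG0 => ?_⟩
  rw [← lintegral_add_right_eq_self (fun y => ENNReal.ofReal (K * (G y * (1 + y ^ 2)⁻¹))) t,
    muAB_eq_withDensity hα, lintegral_withDensity_eq_lintegral_mul _ (measurable_cauchyPDF _ _)
      (by fun_prop)]
  refine lintegral_mono fun x => ?_
  rw [Pi.mul_apply, cauchyPDF, ← ENNReal.ofReal_mul' (hG0 _)]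
  refine ENNReal.ofReal_le_ofReal ?_
  calc _ ≤ K * (1 + (x + t) ^ 2)⁻¹ * G (x + t) :=
        mul_le_mul_of_nonneg_right (h x) (hG0 _)
    _ = _ := by ring

lemma inv_one_add_sq_le (y : ℝ) : (1 + y ^ 2)⁻¹ ≤ 2 * ((1 + |y|) ^ 2)⁻¹ := by
  rw [← div_eq_mul_inv, le_div_iff₀ (by positivity), inv_mul_le_iff₀ (by positivity)]
  nlinarith [sq_abs y, sq_nonneg (1 - |y|)]

lemma sq_norm_sub_one (σ y : ℝ) :
    ‖(σ + Complex.I * y - 1 : ℂ)‖ ^ 2 = y ^ 2 + (1 - σ) ^ 2 := by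
  rw [Complex.sq_norm, Complex.normSq_apply]
  simp
  ring

lemma ofReal_add_I_mul_ne_one {σ : ℝ} (h : σ < 1) (y : ℝ) : (σ + Complex.I * y : ℂ) ≠ 1 := by
  intro e
  have := congrArg Complex.re e
  simp at this
  exact h.ne this

/-- Mean square of `ζ` on vertical lines, uniformly in the abscissa. -/
lemma exists_norm_riemannZeta_sq_mul_le :
    ∃ K : ℝ, 0 < K ∧ ∀ σ y : ℝ, 1 / 2 < σ → σ < 1 →
      ‖riemannZeta (σ + Complex.I * y)‖ ^ 2 * (1 + y ^ 2)⁻¹ ≤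
        K * ((y ^ 2 + (1 - σ) ^ 2)⁻¹ + (1 + |y|) ^ (-(5 / 4) : ℝ)) := by
  -- For σ > 1/2 the exponent is at most 1 + 1/8 + 1/4 = 11/8. Its double exceeds 2 by 3/4, and 3/4
  -- - 2 = -5/4 is still integrable.
  obtain ⟨K, hK, h⟩ := exists_norm_riemannZeta₁_le_convexity (ε := 1 / 8) (by norm_num) (by norm_num)
  refine ⟨K ^ 2 * 2 * 4, by positivity, fun σ y h1 h2 => ?_⟩
  have hb : 1 ≤ 1 + |y| := by linarith [abs_nonneg y]
  have hZ := h (σ + Complex.I * y) (by simp; linarith) (by simp; linarith)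
  simp only [Complex.add_im, Complex.ofReal_im, Complex.mul_im, Complex.I_re, zero_mul,
    Complex.I_im, Complex.ofReal_re, one_mul, zero_add, Complex.add_re, Complex.mul_re,
    sub_self, mul_zero, add_zero] at hZ
  have hZ2 : ‖riemannZeta₁ (σ + Complex.I * y)‖ ^ 2 ≤ K ^ 2 * ((1 + |y|) ^ 2 *
      (1 + |y|) ^ (3 / 4 : ℝ)) := by
    have e : (1 + |y|) ^ 2 * (1 + |y|) ^ (3 / 4 : ℝ) = ((1 + |y|) ^ (11 / 8 : ℝ)) ^ 2 := by
      rw [← Real.rpow_natCast, ← Real.rpow_natCast, ← Real.rpow_add (by linarith),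
        ← Real.rpow_mul (by linarith)]
      norm_num
    rw [e, ← mul_pow]
    gcongr
    refine hZ.trans ?_
    gcongr
    linarith
  have hD : 0 < y ^ 2 + (1 - σ) ^ 2 := by
    have : 0 < 1 - σ := by linarith
    positivity
  -- For |y| ≤ 1 the pole factor is kept intact, since it alone carries the dependence on σ; for |y|
  -- ≥ 1 it is at most 4(1 + |y|)⁻².
  have hsplit : (1 + |y|) ^ (3 / 4 : ℝ) * (y ^ 2 + (1 - σ) ^ 2)⁻¹ ≤
      4 * ((y ^ 2 + (1 - σ) ^ 2)⁻¹ + (1 + |y|) ^ (-(5 / 4) : ℝ)) := by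
    have hr : 0 < (1 + |y|) ^ (-(5 / 4) : ℝ) := by positivity
    have hDi : 0 < (y ^ 2 + (1 - σ) ^ 2)⁻¹ := by positivity
    rcases le_total |y| 1 with hy | hy
    · have : (1 + |y|) ^ (3 / 4 : ℝ) ≤ 4 := by
        calc (1 + |y|) ^ (3 / 4 : ℝ) ≤ (1 + |y|) ^ (1 : ℝ) := by
              gcongr
              · norm_num
          _ ≤ 4 := by rw [Real.rpow_one]; linarith
      nlinarith
    · have e : (1 + |y|) ^ (3 / 4 : ℝ) = (1 + |y|) ^ 2 * (1 + |y|) ^ (-(5 / 4) : ℝ) := by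
        rw [← Real.rpow_natCast, ← Real.rpow_add (by linarith)]
        norm_num
      have h4 : (1 + |y|) ^ 2 * (y ^ 2 + (1 - σ) ^ 2)⁻¹ ≤ 4 := by
        rw [← div_eq_mul_inv, div_le_iff₀ hD]
        nlinarith [sq_abs y, sq_nonneg (1 - σ)]
      rw [e]
      nlinarith
  have hinv := inv_one_add_sq_le y
  rw [riemannZeta_eq_inv_sub_mul (ofReal_add_I_mul_ne_one h2 y), norm_mul, norm_inv, mul_pow,
    inv_pow, sq_norm_sub_one]
  calc _ ≤ (y ^ 2 + (1 - σ) ^ 2)⁻¹ * (K ^ 2 * ((1 + |y|) ^ 2 * (1 + |y|) ^ (3 / 4 : ℝ))) *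
        (2 * ((1 + |y|) ^ 2)⁻¹) := by gcongr
    _ = K ^ 2 * 2 * ((1 + |y|) ^ (3 / 4 : ℝ) * (y ^ 2 + (1 - σ) ^ 2)⁻¹) := by
        field_simp
    _ ≤ K ^ 2 * 2 * (4 * ((y ^ 2 + (1 - σ) ^ 2)⁻¹ + (1 + |y|) ^ (-(5 / 4) : ℝ))) := by gcongr
    _ = _ := by ring

/-- Fourth power of `ζ` on a vertical line to the right of the critical line. -/
lemma exists_norm_riemannZeta_pow_four_mul_le {σ : ℝ} (h1 : 1 / 2 < σ) (h2 : σ < 1) :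
    ∃ K : ℝ, 0 < K ∧ ∀ y : ℝ, ‖riemannZeta (σ + Complex.I * y)‖ ^ 4 * (1 + y ^ 2)⁻¹ ≤
        K * (1 + |y|) ^ (-(σ + 1 / 2)) := by
  -- After division by s - 1 the exponent is e = ε + (1 - σ)/2, and this ε makes 4e - 2 = -(σ +
  -- 1/2), which is below -1 exactly when σ > 1/2.
  obtain ⟨K, hK, h⟩ := exists_norm_riemannZeta₁_le_convexity (ε := (2 * σ - 1) / 8)
    (by linarith) (by linarith)
  have hσ : 0 < 1 - σ := by linarith
  refine ⟨(2 / (1 - σ) * K) ^ 4 * 2, by positivity, fun y => ?_⟩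
  have hb : 0 < 1 + |y| := by positivity
  have hZ := h (σ + Complex.I * y) (by simp; linarith) (by simp; linarith)
  simp only [Complex.add_im, Complex.ofReal_im, Complex.mul_im, Complex.I_re, zero_mul,
    Complex.I_im, Complex.ofReal_re, one_mul, zero_add, Complex.add_re, Complex.mul_re,
    sub_self, mul_zero, add_zero] at hZ
  set e : ℝ := (2 * σ - 1) / 8 + (1 - σ) / 2 with he
  have hZ' : ‖riemannZeta₁ (σ + Complex.I * y)‖ ≤ K * ((1 + |y|) * (1 + |y|) ^ e) := by
    refine hZ.trans (le_of_eq ?_)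
    rw [add_assoc, ← he, Real.rpow_add hb, Real.rpow_one]
  have hden : (1 - σ) / 2 * (1 + |y|) ≤ ‖(σ + Complex.I * y - 1 : ℂ)‖ := by
    have ha := Complex.abs_re_le_norm (σ + Complex.I * y - 1 : ℂ)
    have hc := Complex.abs_im_le_norm (σ + Complex.I * y - 1 : ℂ)
    simp only [Complex.sub_re, Complex.add_re, Complex.ofReal_re, Complex.mul_re, Complex.I_re,
      zero_mul, Complex.I_im, Complex.ofReal_im, mul_zero, sub_self, add_zero,
      Complex.one_re, Complex.sub_im, Complex.add_im, Complex.mul_im, one_mul, zero_add,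
      Complex.one_im, sub_zero] at ha hc
    have : 1 - σ ≤ ‖(σ + Complex.I * y - 1 : ℂ)‖ := by
      rw [abs_of_neg (by linarith)] at ha
      linarith
    nlinarith [abs_nonneg y]
  have hzeta : ‖riemannZeta (σ + Complex.I * y)‖ ≤ 2 / (1 - σ) * K * (1 + |y|) ^ e := by
    rw [riemannZeta_eq_inv_sub_mul (ofReal_add_I_mul_ne_one h2 y), norm_mul, norm_inv]
    calc _ ≤ ((1 - σ) / 2 * (1 + |y|))⁻¹ * (K * ((1 + |y|) * (1 + |y|) ^ e)) := by gcongr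
      _ = _ := by field_simp
  calc _ ≤ (2 / (1 - σ) * K * (1 + |y|) ^ e) ^ 4 * (2 * ((1 + |y|) ^ 2)⁻¹) := by
        gcongr
        exact inv_one_add_sq_le y
    _ = (2 / (1 - σ) * K) ^ 4 * 2 * (((1 + |y|) ^ e) ^ 4 * ((1 + |y|) ^ 2)⁻¹) := by ring
    _ = _ := by
        congr 1
        rw [← Real.rpow_natCast, ← Real.rpow_mul hb.le, ← Real.rpow_natCast,
          ← Real.rpow_neg hb.le, ← Real.rpow_add hb]
        congr 1
        rw [he]
        push_cast
        ring

lemma integrable_one_add_abs_rpow_neg {r : ℝ} (hr : 1 < r) :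
    Integrable fun y : ℝ => (1 + |y|) ^ (-r) := by
  simpa using! integrable_one_add_norm (E := ℝ) (μ := volume) (r := r) (by simpa using hr)

lemma inv_sq_add_sq_eq {a : ℝ} (ha : 0 < a) (y : ℝ) :
    (y ^ 2 + a ^ 2)⁻¹ = Real.pi / a * cauchyPDFReal 0 a.toNNReal y := by
  rw [cauchyPDFReal_toNNReal ha, sub_zero]
  field_simp

lemma integrable_inv_sq_add_sq {a : ℝ} (ha : 0 < a) :
    Integrable fun y : ℝ => (y ^ 2 + a ^ 2)⁻¹ := by
  simp_rw [inv_sq_add_sq_eq ha]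
  exact (integrable_cauchyPDFReal 0).const_mul _

lemma integral_univ_inv_sq_add_sq {a : ℝ} (ha : 0 < a) :
    ∫ y : ℝ, (y ^ 2 + a ^ 2)⁻¹ = Real.pi / a := by
  simp_rw [inv_sq_add_sq_eq ha]
  rw [integral_const_mul, integral_cauchyPDFReal_eq_one 0 (by simpa using ha), mul_one]

lemma enorm_riemannZeta_line_pow (σ t x : ℝ) (n : ℕ) :
    ‖riemannZeta (σ + t * Complex.I + Complex.I * x)‖ₑ ^ n =
      ENNReal.ofReal (‖riemannZeta (σ + Complex.I * ((x + t : ℝ) : ℂ))‖ ^ n) := by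
  rw [ENNReal.ofReal_pow (norm_nonneg _), ofReal_norm]
  congr 3
  push_cast
  ring

lemma measurable_norm_riemannZeta_line_pow (σ : ℝ) (n : ℕ) :
    Measurable fun y : ℝ => ‖riemannZeta (σ + Complex.I * y)‖ ^ n :=
  (measurable_riemannZeta.comp (by fun_prop)).norm.pow_const n

/-- The pole contributes the Cauchy integral π/(1 - σ); the remainder has an integral J independent
of σ, and J ≤ J/(1 - σ). -/
theorem exists_lintegral_riemannZeta_sq_le {α : ℝ} (hα : 0 < α) (β t : ℝ) :
    ∃ C : ℝ, 0 < C ∧ ∀ σ : ℝ, 1 / 2 < σ → σ < 1 →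
      ∫⁻ x : ℝ, ‖riemannZeta (σ + t * Complex.I + Complex.I * x)‖ₑ ^ 2 ∂(muAB α β) ≤
        ENNReal.ofReal (C / (1 - σ)) := by
  obtain ⟨K, hK, hμ⟩ := exists_lintegral_muAB_le hα β t
  obtain ⟨M, hM, hζ⟩ := exists_norm_riemannZeta_sq_mul_le
  set J : ℝ := ∫ y : ℝ, (1 + |y|) ^ (-(5 / 4) : ℝ) with hJ
  have hJ0 : 0 ≤ J := integral_nonneg fun y => by positivity
  have hJi := integrable_one_add_abs_rpow_neg (by norm_num : (1 : ℝ) < 5 / 4)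
  refine ⟨K * M * (Real.pi + J), by positivity, fun σ h1 h2 => ?_⟩
  have ha : 0 < 1 - σ := by linarith
  simp_rw [enorm_riemannZeta_line_pow]
  refine (hμ _ (measurable_norm_riemannZeta_line_pow σ 2) fun y => by positivity).trans ?_
  have hI : Integrable fun y : ℝ =>
      K * M * ((y ^ 2 + (1 - σ) ^ 2)⁻¹ + (1 + |y|) ^ (-(5 / 4) : ℝ)) :=
    ((integrable_inv_sq_add_sq ha).add hJi).const_mul (K * M)
  calc _ ≤ ∫⁻ y : ℝ, ENNReal.ofReal
        (K * M * ((y ^ 2 + (1 - σ) ^ 2)⁻¹ + (1 + |y|) ^ (-(5 / 4) : ℝ))) := by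
        refine lintegral_mono fun y => ENNReal.ofReal_le_ofReal ?_
        rw [mul_assoc]
        exact mul_le_mul_of_nonneg_left (hζ σ y h1 h2) hK.le
    _ = ENNReal.ofReal (K * M * (Real.pi / (1 - σ) + J)) := by
        rw [← ofReal_integral_eq_lintegral_ofReal hI (ae_of_all _ fun y => by
          have : 0 < y ^ 2 + (1 - σ) ^ 2 := by positivity
          simp only [Pi.zero_apply]
          positivity)]
        congr 1
        rw [integral_const_mul, integral_add (integrable_inv_sq_add_sq ha) hJi,
          integral_univ_inv_sq_add_sq ha]
    _ ≤ _ := by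
        refine ENNReal.ofReal_le_ofReal ?_
        rw [mul_div_assoc]
        gcongr
        rw [add_div]
        gcongr
        rw [le_div_iff₀ ha]
        nlinarith

theorem lintegral_riemannZeta_pow_four_ne_top {α : ℝ} (hα : 0 < α) (β t : ℝ) {σ : ℝ}
    (h1 : 1 / 2 < σ) (h2 : σ < 1) :
    ∫⁻ x : ℝ, ‖riemannZeta (σ + t * Complex.I + Complex.I * x)‖ₑ ^ 4 ∂(muAB α β) ≠ ⊤ := by
  obtain ⟨K, hK, hμ⟩ := exists_lintegral_muAB_le hα β t
  obtain ⟨M, hM, hζ⟩ := exists_norm_riemannZeta_pow_four_mul_le h1 h2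
  simp_rw [enorm_riemannZeta_line_pow]
  refine ne_top_of_le_ne_top ?_
    (hμ _ (measurable_norm_riemannZeta_line_pow σ 4) fun y => by positivity)
  refine ne_top_of_le_ne_top ?_ (lintegral_mono fun y => ENNReal.ofReal_le_ofReal
    (mul_le_mul_of_nonneg_left (hζ y) hK.le))
  exact (((integrable_one_add_abs_rpow_neg (by linarith : 1 < σ + 1 / 2)).const_mul M).const_mul
    K).lintegral_lt_top.ne

/-! ### Assembly of the two estimates -/

theorem theorem1p4 (α β : ℝ) (hα : 0 < α) (t : ℝ) (k : ℕ → ℕ)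
    (hk : ∃ p : ℝ≥0∞, 2 < p ∧ IsGoodUniversal p k) :
    (∃ C : ℝ, 0 < C ∧ ∀ σ : ℝ, 1 / 2 < σ → σ < 1 →
      ∑' N : ℕ, eLpNorm (fun x => zetaAvg α β (σ + t * Complex.I) k (N + 2) x
          - zetaAvg α β (σ + t * Complex.I) k (N + 1) x) 2 (muAB α β) ^ 2
        ≤ ENNReal.ofReal (C / (Real.pi * σ) * zetaBound σ)) ∧
    (∀ σ : ℝ, 1 / 2 < σ → σ < 1 →
      ∃ C : ℝ, 0 < C ∧ ∀ lam : ℝ, 0 < lam →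
        muAB α β {x | ENNReal.ofReal lam ≤ squareVar α β (σ + t * Complex.I) k x}
          ≤ ENNReal.ofReal (C / lam ^ 2 * zetaBound σ)) := by
  have hT := measurePreserving_boolMap hα β
  have hf : ∀ s : ℂ, Measurable fun x : ℝ => riemannZeta (s + Complex.I * x) := fun s =>
    measurable_riemannZeta.comp (by fun_prop)
  have havg : ∀ s : ℂ, zetaAvg α β s k =
      seqAvg (boolMap α β) (fun x : ℝ => riemannZeta (s + Complex.I * x)) k := fun s => rfl
  have hW := tsum_enorm_one_div_sq_ne_top
  set W := ∑' N : ℕ, ‖(1 / (N + 2 : ℂ))‖ₑ ^ 2 with hWdef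
  constructor
  · obtain ⟨A, hA, hL2⟩ := exists_lintegral_riemannZeta_sq_le hα β t
    -- The bound 4WA/(1 - σ) is 16WA times 1/(4(1 - σ)), the lower bound for the zeta expression.
    -- The π cancels the one in the statement, σ < 1 absorbs the remaining 1/σ, and + 1 ensures
    -- positivity.
    refine ⟨Real.pi * (16 * W.toReal * A) + 1, by positivity, fun σ h1 h2 => ?_⟩
    simp_rw [havg]
    refine (tsum_eLpNorm_seqAvg_sub_sq_le hT (hf _) one_le_two k).trans ?_
    have h2norm : eLpNorm (fun x : ℝ => riemannZeta (σ + t * Complex.I + Complex.I * x)) 2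
        (muAB α β) ^ 2 = ∫⁻ x : ℝ, ‖riemannZeta (σ + t * Complex.I + Complex.I * x)‖ₑ ^ 2
          ∂(muAB α β) := by
      have := eLpNorm_nnreal_pow_eq_lintegral (μ := muAB α β)
        (f := fun x : ℝ => riemannZeta (σ + t * Complex.I + Complex.I * x)) (p := 2) (by norm_num)
      simp only [NNReal.coe_ofNat, ENNReal.coe_ofNat] at this
      exact_mod_cast this
    have ha : 0 < 1 - σ := by linarith
    have hz := inv_le_zetaBound h1 h2
    rw [mul_pow, h2norm, ← hWdef]
    calc W * (2 ^ 2 * _) ≤ ENNReal.ofReal W.toReal * (ENNReal.ofReal 4 *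
          ENNReal.ofReal (A / (1 - σ))) := by
          rw [ENNReal.ofReal_toReal hW]
          gcongr
          · norm_num
          · exact hL2 σ h1 h2
      _ = ENNReal.ofReal (16 * W.toReal * A * (1 / (4 * (1 - σ)))) := by
          rw [← ENNReal.ofReal_mul (by norm_num), ← ENNReal.ofReal_mul ENNReal.toReal_nonneg]
          congr 1
          field_simp
          ring
      _ ≤ _ := by
          refine ENNReal.ofReal_le_ofReal ?_
          have hzb : 0 ≤ zetaBound σ := norm_nonneg _
          gcongr
          rw [le_div_iff₀ (by positivity)]
          have : 0 ≤ Real.pi * (16 * W.toReal * A) := by positivity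
          nlinarith
  · intro σ h1 h2
    have ha : 0 < 1 - σ := by linarith
    have hzb : 0 < zetaBound σ := lt_of_lt_of_le (by positivity) (inv_le_zetaBound h1 h2)
    have hL4 := lintegral_riemannZeta_pow_four_ne_top hα β t h1 h2
    set B := 2 * W ^ 2 * (16 * ∫⁻ x : ℝ,
      ‖riemannZeta (σ + t * Complex.I + Complex.I * x)‖ₑ ^ 4 ∂(muAB α β)) with hB
    have hBtop : B ≠ ⊤ := by
      rw [hB]
      finiteness
    -- Since the constant may depend on σ, dividing by the positive zeta expression inserts it into
    -- the bound.
    refine ⟨B.toReal / zetaBound σ + 1, by positivity, fun lam hlam => ?_⟩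
    have key := mul_measure_le_tsum_seqAvg_sub_sq hT (hf (σ + t * Complex.I)) k
      (ENNReal.ofReal lam)
    rw [← havg, ← hWdef, ← hB, ← ENNReal.ofReal_toReal hBtop, ← ENNReal.ofReal_pow hlam.le] at key
    have hl2 : 0 < lam ^ 2 := by positivity
    calc _ ≤ ENNReal.ofReal B.toReal / ENNReal.ofReal (lam ^ 2) := by
          rw [ENNReal.le_div_iff_mul_le (Or.inl (by simpa using hlam.ne')) (Or.inl (by simp)),
            mul_comm]
          exact key
      _ = ENNReal.ofReal (B.toReal / lam ^ 2) := (ENNReal.ofReal_div_of_pos hl2).symm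
      _ ≤ _ := by
          refine ENNReal.ofReal_le_ofReal ?_
          rw [div_mul_eq_mul_div]
          gcongr
          rw [add_mul, div_mul_cancel₀ _ hzb.ne']
          linarith
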